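/- Let $p$ be a prime, $K$ a field of characteristic $p$, $\delta:K\to K$ a derivation (an additive map with $\delta(ab)=a\delta(b)+\delta(a)b$) and $F=\{a\in K\mid\delta(a)=0\}$ its field of constants. Assume that $\delta$, as an $F$-linear endomorphism of $K$, has minimum polynomial $t^p-t\in F[t]$. Let $R=K[t;\delta]$ be the differential polynomial ring, whose elements are the polynomials $\sum a_it^i$ with $a_i\in K$, with term-wise addition and with the multiplication determined by $ta=at+\delta(a)$ for $a\in K$. Let $d\in K$ and $f=t^p-t-d\in R$, and let $(K,\delta,d)=S_f=R/Rf$ be the unital, not necessarily associative, $F$-algebra that consists of the $g\in R$ of degree less than $p$, with the multiplication $g\circ h=$ the remainder $r$ of $gh$ under right division by $f$ (that is, $gh=qf+r$ with $q,r\in R$, $\deg r<p$). For $z\in K$ let $V_p(z)\in K$ be the element with $(t-z)^p=t^p-V_p(z)$ in $R$; such an element exists. Then: (1) $(K,\delta,d)$ has dimension $p^2$ over $F$. (2) $(K,\delta,d)$ is a division algebra (it is nonzero, and all left and all right multiplications by nonzero elements are bijective) if and only if $V_p(z)-z\neq d$ for all $z\in K$, if and only if $z^p+\delta^{p-1}(z)-z\neq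 d$ for all $z\in K$. (3) The map $G=G_{\mathrm{id},-1}$, $\sum a_it^i\mapsto\sum a_i(t-1)^i$, is an $F$-algebra automorphism of $(K,\delta,d)$; it satisfies $G(t)=t-1$ and $G|_K=\mathrm{id}_K$, and it generates a cyclic subgroup of order $p$ of $\mathrm{Aut}_F((K,\delta,d))$. -/

import Mathlib

noncomputable section

open Polynomial

/-! ### Constants of a derivation -/

/-- The field of constants `Const(δ) = {a ∈ K | δ a = 0}` of a derivation of a field. -/
def constants {K : Type*} [Field K] (δ : Derivation ℤ K K) : Subfield K where
  carrier := {a | δ a = 0}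
  mul_mem' := by
    intro a b ha hb
    simp only [Set.mem_ofPred_eq] at ha hb ⊢
    simp [Derivation.leibniz, ha, hb]
  one_mem' := by simp
  add_mem' := by
    intro a b ha hb
    simp only [Set.mem_ofPred_eq] at ha hb ⊢
    simp [ha, hb]
  zero_mem' := by simp
  neg_mem' := by
    intro a ha
    simp only [Set.mem_ofPred_eq] at ha ⊢
    simp [ha]
  inv_mem' := by
    intro a ha
    simp only [Set.mem_ofPred_eq] at ha ⊢
    simp [Derivation.leibniz_inv, ha]

/-- A derivation of `K`, seen as an endomorphism of `K` as a vector space over its constants. -/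
def constLinear {K : Type*} [Field K] (δ : Derivation ℤ K K) :
    Module.End (constants δ) K where
  toFun := δ
  map_add' := δ.map_add
  map_smul' := by
    rintro ⟨c, hc⟩ x
    have hc' : δ c = 0 := hc
    change δ (c * x) = c * δ x
    simp [Derivation.leibniz, hc']

/-! ### The differential polynomial ring -/

/-- The differential polynomial ring `K[t;δ]`. Its elements are the polynomials
`a₀ + a₁ t + ⋯ + aₙ tⁿ` with coefficients written on the left; the addition is term-wise, and the
multiplication, defined below, is the one with `t a = a t + δ a`. -/
def DiffPoly {K : Type*} [Field K] (_δ : Derivation ℤ K K) : Type _ := K[X]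

namespace DiffPoly

variable {K : Type*} [Field K] {δ : Derivation ℤ K K}

instance : AddCommGroup (DiffPoly δ) := inferInstanceAs (AddCommGroup K[X])

instance : Module K (DiffPoly δ) := inferInstanceAs (Module K K[X])

/-- The ordinary polynomial with the same (left) coefficients. -/
def toPoly : DiffPoly δ ≃ₗ[K] K[X] := LinearEquiv.refl K K[X]

/-- The element `∑ aᵢ tⁱ` of `K[t;δ]`, for a polynomial `∑ aᵢ Xⁱ`. -/
def ofPoly : K[X] ≃ₗ[K] DiffPoly δ := LinearEquiv.refl K K[X]

@[simp] lemma toPoly_ofPoly (q : K[X]) : toPoly (ofPoly q : DiffPoly δ) = q := rfl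

@[simp] lemma ofPoly_toPoly (q : DiffPoly δ) : ofPoly (toPoly q) = q := rfl

/-- The application of `δ` to every coefficient. -/
def coeffDeriv (δ : Derivation ℤ K K) : K[X] →+ K[X] where
  toFun q := q.sum fun j b => monomial j (δ b)
  map_zero' := by simp
  map_add' x y := by
    rw [sum_add_index] <;> simp

@[simp] lemma coeffDeriv_monomial (j : ℕ) (b : K) :
    coeffDeriv δ (monomial j b) = monomial j (δ b) := by
  simp [coeffDeriv, sum_monomial_index]

/-- Left multiplication by `t`: `t (∑ bⱼ tʲ) = ∑ (bⱼ tʲ⁺¹ + δ(bⱼ) tʲ)`. -/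
def tMul (δ : Derivation ℤ K K) : K[X] →+ K[X] where
  toFun q := X * q + coeffDeriv δ q
  map_zero' := by simp
  map_add' x y := by
    rw [map_add]; ring

lemma tMul_apply (q : K[X]) : tMul δ q = X * q + coeffDeriv δ q := rfl

lemma tMul_monomial (j : ℕ) (b : K) :
    tMul δ (monomial j b) = monomial (j + 1) b + monomial j (δ b) := by
  rw [tMul_apply, X_mul_monomial, coeffDeriv_monomial]

lemma coeffDeriv_smul (a : K) (q : K[X]) :
    coeffDeriv δ (a • q) = a • coeffDeriv δ q + δ a • q := by
  induction q using Polynomial.induction_on' with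
  | add x y hx hy => simp only [smul_add, map_add, hx, hy]; abel
  | monomial n b =>
    simp only [smul_monomial, coeffDeriv_monomial, smul_eq_mul, Derivation.leibniz, map_add]
    rw [mul_comm b]

lemma tMul_smul (a : K) (q : K[X]) : tMul δ (a • q) = a • tMul δ q + δ a • q := by
  rw [tMul_apply, tMul_apply, coeffDeriv_smul, mul_smul_comm, smul_add]; abel

/-- The product of `∑ aᵢ tⁱ` and `q`, namely `∑ aᵢ (t (t (⋯ (t q))))` with `i` factors `t`. -/
def leftMul (δ : Derivation ℤ K K) (g q : K[X]) : K[X] :=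
  g.sum fun i a => a • (tMul δ)^[i] q

lemma leftMul_monomial (i : ℕ) (a : K) (q : K[X]) :
    leftMul δ (monomial i a) q = a • (tMul δ)^[i] q :=
  sum_monomial_index _ _ (zero_smul K _)

lemma add_leftMul (g h q : K[X]) : leftMul δ (g + h) q = leftMul δ g q + leftMul δ h q :=
  sum_add_index _ _ _ (fun _ => zero_smul K _) (fun _ _ _ => add_smul _ _ _)

lemma zero_leftMul (q : K[X]) : leftMul δ 0 q = 0 := sum_zero_index _

lemma leftMul_add (g x y : K[X]) : leftMul δ g (x + y) = leftMul δ g x + leftMul δ g y := by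
  simp only [leftMul, iterate_map_add, smul_add]
  exact sum_add g _ _

lemma leftMul_zero (g : K[X]) : leftMul δ g 0 = 0 := by
  simp [leftMul, Polynomial.sum]

lemma smul_leftMul (a : K) (g q : K[X]) : leftMul δ (a • g) q = a • leftMul δ g q := by
  induction g using Polynomial.induction_on' with
  | add x y hx hy => rw [smul_add, add_leftMul, add_leftMul, hx, hy, smul_add]
  | monomial n b => rw [smul_monomial, leftMul_monomial, leftMul_monomial, smul_assoc]

lemma tMul_leftMul (g q : K[X]) : leftMul δ (tMul δ g) q = tMul δ (leftMul δ g q) := by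
  induction g using Polynomial.induction_on' with
  | add x y hx hy => rw [map_add, add_leftMul, add_leftMul, hx, hy, map_add]
  | monomial n b =>
    rw [tMul_monomial, add_leftMul, leftMul_monomial, leftMul_monomial,
      leftMul_monomial, tMul_smul, Function.iterate_succ_apply']

lemma leftMul_assoc (g h q : K[X]) :
    leftMul δ (leftMul δ g h) q = leftMul δ g (leftMul δ h q) := by
  induction g using Polynomial.induction_on' with
  | add x y hx hy => rw [add_leftMul, add_leftMul, add_leftMul, hx, hy]
  | monomial n b =>
    rw [leftMul_monomial, leftMul_monomial, smul_leftMul]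
    congr 1
    induction n with
    | zero => rfl
    | succ n ih => rw [Function.iterate_succ_apply', Function.iterate_succ_apply', tMul_leftMul, ih]

lemma one_leftMul (q : K[X]) : leftMul δ 1 q = q := by
  rw [← monomial_zero_one, leftMul_monomial, Function.iterate_zero_apply, one_smul]

lemma tMul_iterate_one (n : ℕ) : (tMul δ)^[n] (1 : K[X]) = X ^ n := by
  induction n with
  | zero => rfl
  | succ n ih =>
    rw [Function.iterate_succ_apply', ih, X_pow_eq_monomial, tMul_monomial,
      Derivation.map_one_eq_zero, map_zero, add_zero, ← X_pow_eq_monomial]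

lemma leftMul_one (g : K[X]) : leftMul δ g 1 = g := by
  induction g using Polynomial.induction_on' with
  | add x y hx hy => rw [add_leftMul, hx, hy]
  | monomial n b => rw [leftMul_monomial, tMul_iterate_one, ← C_mul_X_pow_eq_monomial, smul_eq_C_mul]

instance : One (DiffPoly δ) := ⟨ofPoly 1⟩

instance : Mul (DiffPoly δ) := ⟨fun g h => ofPoly (leftMul δ (toPoly g) (toPoly h))⟩

lemma toPoly_one : toPoly (1 : DiffPoly δ) = 1 := rfl

lemma toPoly_mul (g h : DiffPoly δ) : toPoly (g * h) = leftMul δ (toPoly g) (toPoly h) := rfl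

instance : Ring (DiffPoly δ) where
  __ := (inferInstance : AddCommGroup (DiffPoly δ))
  mul_assoc a b c := toPoly.injective <| by simp only [toPoly_mul, leftMul_assoc]
  one_mul a := toPoly.injective <| by rw [toPoly_mul, toPoly_one, one_leftMul]
  mul_one a := toPoly.injective <| by rw [toPoly_mul, toPoly_one, leftMul_one]
  left_distrib a b c := toPoly.injective <| by simp only [toPoly_mul, map_add, leftMul_add]
  right_distrib a b c := toPoly.injective <| by simp only [toPoly_mul, map_add, add_leftMul]
  zero_mul a := toPoly.injective <| by rw [toPoly_mul, map_zero, zero_leftMul]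
  mul_zero a := toPoly.injective <| by rw [toPoly_mul, map_zero, leftMul_zero]

/-- The indeterminate `t`. -/
def t : DiffPoly δ := ofPoly X

/-- The constant polynomial `a`. -/
def const (a : K) : DiffPoly δ := ofPoly (C a)

lemma toPoly_t : toPoly (t : DiffPoly δ) = X := rfl

lemma toPoly_const (a : K) : toPoly (const a : DiffPoly δ) = C a := rfl

lemma const_mul (a : K) (g : DiffPoly δ) : const a * g = a • g := by
  apply toPoly.injective
  rw [toPoly_mul, toPoly_const, ← monomial_zero_left, leftMul_monomial,
    Function.iterate_zero_apply, map_smul]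

/-- The commutation rule of `K[t;δ]`. -/
lemma t_mul_const (a : K) : (t : DiffPoly δ) * const a = const a * t + const (δ a) := by
  apply toPoly.injective
  rw [const_mul, map_add, map_smul, toPoly_mul, toPoly_t, toPoly_const, toPoly_const,
    ← monomial_one_one_eq_X, leftMul_monomial, Function.iterate_one, one_smul,
    ← monomial_zero_left, tMul_monomial, smul_monomial, smul_eq_mul, mul_one, zero_add,
    monomial_zero_left]

lemma smul_mul (a : K) (g h : DiffPoly δ) : (a • g) * h = a • (g * h) := by
  rw [← const_mul, ← const_mul, mul_assoc]

lemma tMul_iterate_smul_of_mem {c : K} (hc : c ∈ constants δ) (n : ℕ) (q : K[X]) :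
    (tMul δ)^[n] (c • q) = c • (tMul δ)^[n] q := by
  have hc' : δ c = 0 := hc
  induction n with
  | zero => rfl
  | succ n ih =>
    rw [Function.iterate_succ_apply', ih, tMul_smul, hc', zero_smul, add_zero,
      Function.iterate_succ_apply']

lemma mul_smul_of_mem {c : K} (hc : c ∈ constants δ) (g h : DiffPoly δ) :
    g * (c • h) = c • (g * h) := by
  apply toPoly.injective
  rw [toPoly_mul, map_smul, map_smul, toPoly_mul]
  simp only [leftMul, Polynomial.sum, tMul_iterate_smul_of_mem hc, Finset.smul_sum]
  exact Finset.sum_congr rfl fun _ _ => smul_comm _ _ _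

lemma toPoly_t_pow (n : ℕ) : toPoly ((t : DiffPoly δ) ^ n) = X ^ n := by
  induction n with
  | zero => rw [pow_zero, pow_zero, toPoly_one]
  | succ n ih =>
    have h : leftMul δ X (toPoly (t ^ n : DiffPoly δ)) = tMul δ (toPoly (t ^ n : DiffPoly δ)) := by
      rw [← monomial_one_one_eq_X, leftMul_monomial, Function.iterate_one, one_smul]
    rw [pow_succ', toPoly_mul, toPoly_t, h, ih, ← tMul_iterate_one (δ := δ) n,
      ← Function.iterate_succ_apply' (tMul δ), tMul_iterate_one]

/-- The degree, with `deg 0 = ⊥`. -/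
def degree (g : DiffPoly δ) : WithBot ℕ := (toPoly g).degree

lemma degree_tMul (q : K[X]) : (tMul δ q).degree = q.degree + 1 := by
  rcases eq_or_ne q 0 with rfl | hq
  · simp
  have h1 : (coeffDeriv δ q).degree ≤ q.degree := by
    change (q.sum fun j b => monomial j (δ b)).degree ≤ _
    refine (degree_sum_le _ _).trans (Finset.sup_le fun j hj => ?_)
    exact (degree_monomial_le _ _).trans (le_degree_of_mem_supp j hj)
  have h2 : (X * q).degree = q.degree + 1 := by rw [Polynomial.degree_mul, degree_X, add_comm]
  rw [tMul_apply, degree_add_eq_left_of_degree_lt, h2]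
  rw [h2]
  refine h1.trans_lt ?_
  rw [degree_eq_natDegree hq]
  exact_mod_cast Nat.lt_succ_self _

lemma degree_tMul_iterate (n : ℕ) (q : K[X]) : ((tMul δ)^[n] q).degree = q.degree + n := by
  induction n with
  | zero => simp
  | succ n ih =>
    rw [Function.iterate_succ_apply', degree_tMul, ih]; push_cast; rw [add_assoc]

lemma degree_smul_ne {a : K} (ha : a ≠ 0) (q : K[X]) : (a • q).degree = q.degree := by
  rw [smul_eq_C_mul, degree_C_mul ha]

lemma degree_mul (g h : DiffPoly δ) : (g * h).degree = g.degree + h.degree := by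
  unfold degree
  rw [toPoly_mul]
  generalize toPoly g = g
  generalize toPoly h = h
  rcases eq_or_ne h 0 with rfl | hh
  · simp [leftMul_zero]
  induction hn : g.natDegree using Nat.strong_induction_on generalizing g with
  | _ n ih =>
    rcases eq_or_ne g 0 with rfl | hg
    · simp [zero_leftMul]
    have hlead : (leftMul δ (monomial n g.leadingCoeff) h).degree = g.degree + h.degree := by
      rw [leftMul_monomial, degree_smul_ne (leadingCoeff_ne_zero.mpr hg), degree_tMul_iterate,
        degree_eq_natDegree hg, hn, add_comm]
    have hsplit : g = monomial n g.leadingCoeff + g.eraseLead := by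
      rw [← hn, add_comm]; exact (eraseLead_add_monomial_natDegree_leadingCoeff g).symm
    have herase : (leftMul δ g.eraseLead h).degree < g.degree + h.degree := by
      rcases eq_or_ne g.eraseLead 0 with h0 | h0
      · rw [h0, zero_leftMul, degree_zero, degree_eq_natDegree hg, degree_eq_natDegree hh]
        exact_mod_cast WithBot.bot_lt_coe _
      · have hlt : g.eraseLead.natDegree < n := by
          rw [← hn]; exact natDegree_lt_natDegree h0 (degree_eraseLead_lt hg)
        rw [ih _ hlt _ rfl, degree_eq_natDegree h0, degree_eq_natDegree hg,
          degree_eq_natDegree hh, hn]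
        exact_mod_cast Nat.add_lt_add_right hlt _
    conv_lhs => rw [hsplit]
    rw [add_leftMul, degree_add_eq_left_of_degree_lt, hlead]
    rw [hlead]; exact herase

lemma degree_add_lt {x y : DiffPoly δ} {n : WithBot ℕ} (hx : x.degree < n) (hy : y.degree < n) :
    (x + y).degree < n := by
  unfold degree at *
  rw [map_add]
  exact (degree_add_le _ _).trans_lt (max_lt hx hy)

lemma degree_smul_lt (c : K) {x : DiffPoly δ} {n : WithBot ℕ} (hx : x.degree < n) :
    (c • x).degree < n := by
  unfold degree at *
  rw [map_smul]
  exact (degree_smul_le _ _).trans_lt hx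

/-! ### Right division with remainder -/

lemma exists_eq_mul_add (f : DiffPoly δ) (hf : 0 < f.degree) (g : DiffPoly δ) :
    ∃ q r : DiffPoly δ, r.degree < f.degree ∧ g = q * f + r := by
  have hf0 : toPoly f ≠ 0 := by
    rintro h
    rw [degree, h, degree_zero] at hf
    exact not_lt_bot hf
  have hfd : f.degree = ((toPoly f).natDegree : ℕ) := degree_eq_natDegree hf0
  induction hn : (toPoly g).natDegree using Nat.strong_induction_on generalizing g with
  | _ n ih =>
    rcases lt_or_ge g.degree f.degree with hlt | hge
    · exact ⟨0, g, hlt, by rw [zero_mul, zero_add]⟩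
    have hg0 : toPoly g ≠ 0 := by
      rintro h
      rw [degree, degree, h, degree_zero, le_bot_iff, degree_eq_bot] at hge
      exact hf0 hge
    have hgd : g.degree = (n : ℕ) := by rw [degree, degree_eq_natDegree hg0, hn]
    have hmn : (toPoly f).natDegree ≤ n := by
      rw [hfd, hgd] at hge; exact_mod_cast hge
    set k := n - (toPoly f).natDegree with hk
    set m₀ : DiffPoly δ := t ^ k * f with hm₀
    have hm₀d : m₀.degree = (n : ℕ) := by
      rw [hm₀, degree_mul, hfd, degree, toPoly_t_pow, degree_X_pow]
      exact_mod_cast Nat.sub_add_cancel hmn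
    have hm₀0 : toPoly m₀ ≠ 0 := by
      rintro h
      rw [degree, h, degree_zero] at hm₀d
      exact WithBot.bot_ne_coe hm₀d
    set c : K := (toPoly g).leadingCoeff / (toPoly m₀).leadingCoeff with hc
    have hc0 : c ≠ 0 :=
      div_ne_zero (leadingCoeff_ne_zero.mpr hg0) (leadingCoeff_ne_zero.mpr hm₀0)
    have hsub : (toPoly (g - c • m₀)).degree < (toPoly g).degree := by
      rw [map_sub, map_smul]
      refine degree_sub_lt_left ?_ hg0 ?_
      · rw [degree_smul_ne hc0]; exact hgd.trans hm₀d.symm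
      · rw [smul_eq_C_mul, leadingCoeff_mul, leadingCoeff_C, hc,
          div_mul_cancel₀ _ (leadingCoeff_ne_zero.mpr hm₀0)]
    have hstep : ∃ q r : DiffPoly δ, r.degree < f.degree ∧ g - c • m₀ = q * f + r := by
      rcases eq_or_ne (toPoly (g - c • m₀)) 0 with h0 | h0
      · refine ⟨0, 0, ?_, ?_⟩
        · rw [degree, map_zero, degree_zero, hfd]; exact WithBot.bot_lt_coe _
        · rw [zero_mul, zero_add]; exact toPoly.injective (h0.trans (map_zero _).symm)
      · exact ih _ (by rw [← hn]; exact natDegree_lt_natDegree h0 hsub) _ rfl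
    obtain ⟨q, r, hr, hqr⟩ := hstep
    refine ⟨c • t ^ k + q, r, hr, ?_⟩
    rw [add_mul, smul_mul, ← hm₀, add_assoc, ← hqr]
    abel

lemma remainder_unique {f : DiffPoly δ} {q q' r r' : DiffPoly δ}
    (hr : r.degree < f.degree) (hr' : r'.degree < f.degree)
    (h : q * f + r = q' * f + r') : r = r' := by
  have h1 : (q - q') * f = r' - r := by
    rw [sub_mul, sub_eq_sub_iff_add_eq_add, h, add_comm]
  have h2 : (r' - r).degree < f.degree := by
    rw [sub_eq_add_neg, ← neg_one_smul K r]
    exact degree_add_lt hr' (degree_smul_lt _ hr)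
  rw [← h1, degree_mul] at h2
  have h3 : q - q' = 0 := by
    by_contra hne
    have hne' : toPoly (q - q') ≠ 0 := fun h0 => hne (toPoly.injective (h0.trans (map_zero _).symm))
    have : f.degree ≤ (q - q').degree + f.degree := by
      conv_lhs => rw [← zero_add f.degree]
      gcongr
      rw [degree, degree_eq_natDegree hne']
      exact_mod_cast Nat.zero_le _
    exact absurd h2 (not_lt.mpr this)
  rw [h3, zero_mul] at h1
  exact (sub_eq_zero.mp h1.symm).symm

/-- The remainder `g mod_r f` of the right division of `g` by `f`, that is, the element `r` with
`deg r < deg f` and `g = q f + r` for some `q`. -/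
def modr (f : DiffPoly δ) (hf : 0 < f.degree) (g : DiffPoly δ) : DiffPoly δ :=
  (exists_eq_mul_add f hf g).choose_spec.choose

lemma degree_modr_lt (f : DiffPoly δ) (hf : 0 < f.degree) (g : DiffPoly δ) :
    (modr f hf g).degree < f.degree :=
  (exists_eq_mul_add f hf g).choose_spec.choose_spec.1

lemma exists_eq_mul_add_modr (f : DiffPoly δ) (hf : 0 < f.degree) (g : DiffPoly δ) :
    ∃ q, g = q * f + modr f hf g :=
  ⟨_, (exists_eq_mul_add f hf g).choose_spec.choose_spec.2⟩

lemma modr_eq {f : DiffPoly δ} (hf : 0 < f.degree) {g q r : DiffPoly δ}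
    (hr : r.degree < f.degree) (h : g = q * f + r) : modr f hf g = r := by
  obtain ⟨q', hq'⟩ := exists_eq_mul_add_modr f hf g
  exact remainder_unique (degree_modr_lt f hf g) hr (hq'.symm.trans h)

lemma modr_of_lt {f : DiffPoly δ} (hf : 0 < f.degree) {g : DiffPoly δ}
    (hg : g.degree < f.degree) : modr f hf g = g :=
  modr_eq hf hg (q := 0) (by rw [zero_mul, zero_add])

lemma modr_add (f : DiffPoly δ) (hf : 0 < f.degree) (g h : DiffPoly δ) :
    modr f hf (g + h) = modr f hf g + modr f hf h := by
  obtain ⟨q, hq⟩ := exists_eq_mul_add_modr f hf g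
  obtain ⟨q', hq'⟩ := exists_eq_mul_add_modr f hf h
  refine modr_eq hf (q := q + q') (degree_add_lt (degree_modr_lt f hf g) (degree_modr_lt f hf h)) ?_
  conv_lhs => rw [hq, hq']
  rw [add_mul]; abel

lemma modr_smul (f : DiffPoly δ) (hf : 0 < f.degree) (c : K) (g : DiffPoly δ) :
    modr f hf (c • g) = c • modr f hf g := by
  obtain ⟨q, hq⟩ := exists_eq_mul_add_modr f hf g
  refine modr_eq hf (q := c • q) (degree_smul_lt c (degree_modr_lt f hf g)) ?_
  conv_lhs => rw [hq]
  rw [smul_add, smul_mul]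

/-- The `K`-subspace `R_m` of the elements of degree less than `m = deg f`. -/
def lowDegree (f : DiffPoly δ) (hf : 0 < f.degree) : Submodule K (DiffPoly δ) where
  carrier := {g | g.degree < f.degree}
  zero_mem' := by
    change (toPoly (0 : DiffPoly δ)).degree < f.degree
    rw [map_zero, degree_zero]; exact bot_le.trans_lt hf
  add_mem' := degree_add_lt
  smul_mem' c _ := degree_smul_lt c

/-- The map `G_{τ,a}` of `K[t;δ]` to itself, `∑ aᵢ tⁱ ↦ ∑ τ(aᵢ) (t + a)ⁱ`. -/
def substMap (δ : Derivation ℤ K K) (τ : K ≃+* K) (a : K) (g : DiffPoly δ) : DiffPoly δ :=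
  (toPoly g).sum fun i c => const (τ c) * (t + const a) ^ i

/-- `V_p(b)`: the element of `K` with `(t - b)^p = t^p - V_p(b)` in `K[t;δ]` in characteristic `p`,
read off as the constant coefficient of `t^p - (t - b)^p`. -/
def vMap (δ : Derivation ℤ K K) (p : ℕ) (b : K) : K :=
  (toPoly ((t : DiffPoly δ) ^ p - (t - const b) ^ p)).coeff 0

end DiffPoly

/-! ### Petit algebras -/

/-- The Petit algebra `S_f = K[t;δ]/K[t;δ]f`: the elements of `K[t;δ]` of degree less than `deg f`,
with the multiplication `g ∘ h = g h mod_r f`. -/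
def PetitAlgebra {K : Type*} [Field K] {δ : Derivation ℤ K K} (f : DiffPoly δ)
    (hf : 0 < f.degree) : Type _ := DiffPoly.lowDegree f hf

namespace PetitAlgebra

open DiffPoly

variable {K : Type*} [Field K] {δ : Derivation ℤ K K} {f : DiffPoly δ} {hf : 0 < f.degree}

instance : AddCommGroup (PetitAlgebra f hf) := inferInstanceAs (AddCommGroup (lowDegree f hf))

instance : Module K (PetitAlgebra f hf) := inferInstanceAs (Module K (lowDegree f hf))

/-- The underlying differential polynomial. -/
def val : PetitAlgebra f hf →ₗ[K] DiffPoly δ := (lowDegree f hf).subtype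

/-- The element of `S_f` given by a differential polynomial of degree less than `deg f`. -/
def mk (g : DiffPoly δ) (hg : g.degree < f.degree) : PetitAlgebra f hf := ⟨g, hg⟩

lemma val_mk (g : DiffPoly δ) (hg : g.degree < f.degree) :
    val (mk g hg : PetitAlgebra f hf) = g := rfl

lemma val_injective : Function.Injective (val : PetitAlgebra f hf →ₗ[K] DiffPoly δ) :=
  Subtype.val_injective

lemma degree_val_lt (x : PetitAlgebra f hf) : (val x).degree < f.degree := x.2

lemma degree_const_lt (hf : 0 < f.degree) (a : K) : (const a : DiffPoly δ).degree < f.degree :=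
  degree_C_le.trans_lt hf

/-- The element `a` of `S_f`, for `a ∈ K`. -/
def ofField (a : K) : PetitAlgebra f hf := mk (const a) (degree_const_lt hf a)

instance : Mul (PetitAlgebra f hf) :=
  ⟨fun g h => mk (modr f hf (val g * val h)) (degree_modr_lt f hf _)⟩

instance : One (PetitAlgebra f hf) := ⟨ofField 1⟩

lemma val_mul (g h : PetitAlgebra f hf) : val (g * h) = modr f hf (val g * val h) := rfl

lemma val_one : val (1 : PetitAlgebra f hf) = 1 := toPoly.injective <| by
  change toPoly (const (1 : K)) = _
  rw [toPoly_const, toPoly_one, C_1]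

lemma modr_zero : modr f hf 0 = 0 := by
  rw [← zero_smul K (0 : DiffPoly δ), modr_smul, zero_smul, zero_smul]

instance : NonAssocRing (PetitAlgebra f hf) where
  __ := (inferInstance : AddCommGroup (PetitAlgebra f hf))
  left_distrib a b c := val_injective <| by
    simp only [val_mul, map_add, mul_add, modr_add]
  right_distrib a b c := val_injective <| by
    simp only [val_mul, map_add, add_mul, modr_add]
  zero_mul a := val_injective <| by rw [val_mul, map_zero, zero_mul, modr_zero]
  mul_zero a := val_injective <| by rw [val_mul, map_zero, mul_zero, modr_zero]
  one_mul a := val_injective <| by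
    rw [val_mul, val_one, one_mul, modr_of_lt hf (degree_val_lt a)]
  mul_one a := val_injective <| by
    rw [val_mul, val_one, mul_one, modr_of_lt hf (degree_val_lt a)]

/-- The multiplication of `S_f` is bilinear over the constants. -/
instance : IsScalarTower (constants δ) (PetitAlgebra f hf) (PetitAlgebra f hf) where
  smul_assoc c x y := val_injective <| by
    change val (((c : K) • x) * y) = val ((c : K) • (x * y))
    rw [val_mul, map_smul, map_smul, smul_mul, modr_smul, val_mul]

instance : SMulCommClass (constants δ) (PetitAlgebra f hf) (PetitAlgebra f hf) where
  smul_comm c x y := val_injective <| by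
    change val ((c : K) • (x * y)) = val (x * ((c : K) • y))
    rw [val_mul, map_smul, map_smul, mul_smul_of_mem c.2, modr_smul, val_mul]

end PetitAlgebra

/-! ### Nonassociative division algebras and automorphisms -/

/-- A nonzero, not necessarily associative algebra is a division algebra if all the left and all
the right multiplications by nonzero elements are bijective. -/
def IsDivisionAlgebra (A : Type*) [NonAssocRing A] : Prop :=
  Nontrivial A ∧ ∀ a : A, a ≠ 0 →
    Function.Bijective (fun x : A => a * x) ∧ Function.Bijective (fun x : A => x * a)

/-- The group `Aut_F(A)` of the `F`-algebra automorphisms of a not necessarily associative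
algebra `A`, as a subgroup of the group of `F`-linear bijections of `A`. -/
def algebraAut (F A : Type*) [Field F] [NonAssocRing A] [Module F A] :
    Subgroup (A ≃ₗ[F] A) where
  carrier := {φ | ∀ x y : A, φ (x * y) = φ x * φ y}
  one_mem' _ _ := rfl
  mul_mem' := by
    intro φ ψ hφ hψ x y
    change φ (ψ (x * y)) = φ (ψ x) * φ (ψ y)
    rw [hψ, hφ]
  inv_mem' := by
    intro φ hφ x y
    change φ.symm (x * y) = φ.symm x * φ.symm y
    apply φ.injective
    rw [hφ, φ.apply_symm_apply, φ.apply_symm_apply, φ.apply_symm_apply]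

/-! ### The algebra `(K, δ, d)` -/

section

open DiffPoly

variable {K : Type*} [Field K]

/-- The polynomial `t^p - t - d` in `K[t;δ]`. -/
def cyclicPoly (δ : Derivation ℤ K K) (p : ℕ) (d : K) : DiffPoly δ := t ^ p - t - const d

lemma degree_cyclicPoly (δ : Derivation ℤ K K) (p : ℕ) [hp : Fact p.Prime] (d : K) :
    (cyclicPoly δ p d).degree = p := by
  have h1 : toPoly (cyclicPoly δ p d) = X ^ p - (X + C d) := by
    rw [cyclicPoly, map_sub, map_sub, toPoly_t_pow, toPoly_t, toPoly_const, sub_sub]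
  rw [DiffPoly.degree, h1, degree_sub_eq_left_of_degree_lt, degree_X_pow]
  rw [degree_X_pow, degree_X_add_C]
  exact_mod_cast hp.out.one_lt

lemma degree_cyclicPoly_pos (δ : Derivation ℤ K K) (p : ℕ) [hp : Fact p.Prime] (d : K) :
    0 < (cyclicPoly δ p d).degree := by
  rw [degree_cyclicPoly]
  exact_mod_cast hp.out.pos

/-- The algebra `(K, δ, d) = S_f` with `f = t^p - t - d`, for `δ` of minimum polynomial
`t^p - t`. -/
abbrev CyclicExt (δ : Derivation ℤ K K) (p : ℕ) [Fact p.Prime] (d : K) : Type _ :=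
  PetitAlgebra (cyclicPoly δ p d) (degree_cyclicPoly_pos δ p d)

/-- The element `t` of `(K, δ, d)`. -/
def CyclicExt.gen (δ : Derivation ℤ K K) (p : ℕ) [hp : Fact p.Prime] (d : K) : CyclicExt δ p d :=
  PetitAlgebra.mk t (by
    rw [degree_cyclicPoly, DiffPoly.degree, toPoly_t, degree_X]
    exact_mod_cast hp.out.one_lt)

end

end

noncomputable section

open Polynomial

/-! ### The `p`-th power of a sum -/

/-! Commutation with `t` acts on `K` as `δ`. Jacobson's formula in characteristic `p` therefore
gives `(t - z)^p = t^p - (z^p + δ^(p-1) z)`, so `V_p(z) = z^p + δ^(p-1)(z)` and the two division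
criteria coincide (`vMap_eq`). Right division of `f = t^p - t - d` by `t - z` leaves the remainder
`V_p(z) - z - d`, so the condition says that `f` has no right factor `t - z`.

Dimension: `S_f` has dimension `p` over `K`. The minimum polynomial `t^p - t` splits with roots `0,
…, p-1`, hence `K` is the sum of the eigenspaces of `δ`; each is a line spanned by a power of one
eigenvector `x` with `δ x = x`, so `[K : F] = p`.

Division: a right factor `t - z` of `f` produces zero divisors at once. For the converse, `δ^p = δ`
makes `t^p - t` central, and two cases arise. If `δ d ≠ 0`, the left ideal `R b + R f` is stable
under right multiplication by `d`. Commutators with `d` lower the degree by exactly one, so the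
ideal contains `1` (`one_mem_of_mul_const_mem`), and `S_f` is always a division algebra. If `δ d =
0`, then `f` is central and `S_f` is an associative ring, simple by the same descent. By Wedderburn
it is `M_n(D)` with `n² [D : F] = p²`. Either `n = 1` and there are no zero divisors, or `n = p` and
`D = F`. In the second case `F^p` is a one-dimensional `K`-space, so `t` acts on a nonzero vector as
some `z ∈ K`, and this `z` violates the condition (`exists_eq_of_matrix_rep`).

Automorphism: `t - 1` satisfies the same commutation rule as `t`, and `(t - 1)^p - (t - 1) = t^p -
t`, so the substitution is a ring map fixing `f` and preserving degree bounds. It descends to `S_f`,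
and its `p`-th power sends `t` to `t - p = t`. -/

lemma derivative_pow_eq_sum {A : Type*} [Ring A] (u : A[X]) (n : ℕ) :
    derivative (u ^ n) = ∑ i ∈ Finset.range n, u ^ i * derivative u * u ^ (n - 1 - i) := by
  induction n with
  | zero => simp
  | succ n ih =>
    rw [pow_succ, derivative_mul, ih, Finset.sum_range_succ, Finset.sum_mul]
    simp only [Nat.add_sub_cancel, Nat.sub_self, pow_zero, mul_one]
    congr 1
    refine Finset.sum_congr rfl fun i hi => ?_
    have : n - i = n - 1 - i + 1 := by have := Finset.mem_range.mp hi; omega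
    rw [this, pow_succ, mul_assoc _ (u ^ _) u]

section CharP

variable {A : Type*} [Ring A] (p : ℕ) [hp : Fact p.Prime] [CharP A p]

/-- By Pascal's rule two neighbouring binomials add up to `p.choose (k + 1)`, which vanishes modulo
`p`; hence the signs alternate. -/
lemma cast_choose_pred_prime {k : ℕ} (hk : k < p) :
    (((p - 1).choose k : ℕ) : A) = (-1) ^ k := by
  induction k with
  | zero => simp
  | succ k ih =>
    have h1 : p.choose (k + 1) = (p - 1).choose k + (p - 1).choose (k + 1) := by
      conv_lhs => rw [← Nat.sub_add_cancel hp.out.one_le]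
      exact Nat.choose_succ_succ _ _
    have h2 : ((p.choose (k + 1) : ℕ) : A) = 0 :=
      (CharP.cast_eq_zero_iff A p _).mpr (hp.out.dvd_choose_self k.succ_ne_zero hk)
    rw [h1, Nat.cast_add, ih (by omega)] at h2
    rw [pow_succ, mul_neg_one]
    exact (neg_eq_of_add_eq_zero_right h2).symm

/-- In characteristic `p`, the sum `∑ uⁱ v uᵖ⁻¹⁻ⁱ` is the iterated commutator
`[u, [u, …, [u, v]]]` with `p - 1` brackets. -/
lemma sum_pow_mul_mul_pow_eq (u : A) (w : ℕ → A) (hw : ∀ k, u * w k - w k * u = w (k + 1)) :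
    ∑ i ∈ Finset.range p, u ^ i * w 0 * u ^ (p - 1 - i) = w (p - 1) := by
  -- The bracket `[u, ·]` is the difference of left and right multiplication by `u`. These two
  -- commute, so its power can be expanded binomially.
  have hiter (n : ℕ) :
      ((LinearMap.mulLeft ℤ u + -LinearMap.mulRight ℤ u) ^ n) (w 0) = w n := by
    induction n with
    | zero => rfl
    | succ n ih =>
      rw [pow_succ', Module.End.mul_apply, ih, ← hw n]
      simp [sub_eq_add_neg]
  have hcomm : Commute (LinearMap.mulLeft ℤ u : Module.End ℤ A) (-LinearMap.mulRight ℤ u) :=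
    Commute.neg_right (LinearMap.commute_mulLeft_right u u)
  rw [← hiter (p - 1), hcomm.add_pow, Nat.sub_add_cancel hp.out.one_le, LinearMap.sum_apply]
  refine Finset.sum_congr rfl fun i hi => ?_
  have hi' : i < p := Finset.mem_range.mp hi
  -- The sign of the binomial coefficient cancels that of right multiplication, as `(-1)^(p-1) = 1`:
  -- by parity for odd `p`, and because `-1 = 1` for `p = 2`.
  have hsign : (-1 : A) ^ i * (-1) ^ (p - 1 - i) = 1 := by
    rw [← pow_add, Nat.add_sub_cancel' (by omega)]
    rcases hp.out.eq_two_or_odd' with h | h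
    · subst h
      have h2 : (2 : A) = 0 := by exact_mod_cast CharP.cast_eq_zero A 2
      have : (1 : A) + 1 = 0 := by rw [one_add_one_eq_two, h2]
      simpa using (neg_eq_of_add_eq_zero_left this)
    · exact (Nat.Odd.sub_odd h odd_one).neg_one_pow
  rw [← Nat.cast_comm, ← nsmul_eq_mul, LinearMap.smul_apply, neg_pow, Module.End.mul_apply,
    LinearMap.pow_mulRight, LinearMap.pow_mulLeft]
  have hneg (n : ℕ) (x : A) : ((-1 : Module.End ℤ A) ^ n) x = (-1) ^ n * x := by
    rcases n.even_or_odd with h | h <;> simp [h.neg_one_pow]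
  rw [Module.End.mul_apply, hneg, nsmul_eq_mul, cast_choose_pred_prime p hi']
  simp only [LinearMap.mulLeft_apply, LinearMap.mulRight_apply]
  rw [← mul_assoc (u ^ i), ← ((Commute.neg_one_left (u ^ i)).pow_left _).eq, mul_assoc ((-1) ^ _),
    ← mul_assoc, hsign, one_mul, mul_assoc]

/-- The bracket of `u` with `∑ uⁱ v uᵖ⁻¹⁻ⁱ` telescopes, which yields `(ad u)^p = ad (u^p)`. -/
lemma pow_char_mul_sub_mul_pow_char (u : A) (w : ℕ → A)
    (hw : ∀ k, u * w k - w k * u = w (k + 1)) : u ^ p * w 0 - w 0 * u ^ p = w p := by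
  have h := hw (p - 1)
  rw [← sum_pow_mul_mul_pow_eq p u w hw, Nat.sub_add_cancel hp.out.one_le, Finset.mul_sum,
    Finset.sum_mul, ← Finset.sum_sub_distrib] at h
  rw [← h]
  have htel := Finset.sum_range_sub (fun i => u ^ i * w 0 * u ^ (p - i)) p
  simp only [Nat.sub_self, pow_zero, mul_one, one_mul, Nat.sub_zero] at htel
  rw [← htel]
  refine Finset.sum_congr rfl fun i hi => ?_
  have hi' : p - i = p - 1 - i + 1 := by have := Finset.mem_range.mp hi; omega
  rw [show p - (i + 1) = p - 1 - i by omega, hi', pow_succ', pow_succ u (p - 1 - i)]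
  simp only [mul_assoc]

/-- **Jacobson's formula** for `(a + b)ᵖ`, when `b` commutes with all the iterated commutators
`w k = [a, [a, …, [a, b]]]`. -/
lemma add_pow_char_of_commute_commutators (a : A) (w : ℕ → A)
    (hw : ∀ k, a * w k - w k * a = w (k + 1)) (hc : ∀ k, Commute (w 0) (w k)) :
    (a + w 0) ^ p = a ^ p + w 0 ^ p + w (p - 1) := by
  -- A central variable is attached to the second summand. The derivative of `u^p` turns out to be
  -- constant, so only the coefficients at `0`, `1` and `p` survive; evaluation at `X = 1` then
  -- gives the formula.
  set u : A[X] := C a + C (w 0) * X with hu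
  have hdu : derivative u = C (w 0) := by simp [hu]
  have hd : derivative (u ^ p) = C (w (p - 1)) := by
    rw [derivative_pow_eq_sum, hdu]
    refine sum_pow_mul_mul_pow_eq (A := A[X]) p u (fun k => C (w k)) fun k => ?_
    have h : C (w 0) * C (w k) = C (w k) * C (w 0) := by rw [← C_mul, (hc k).eq, C_mul]
    rw [hu, add_mul, mul_add, mul_assoc _ X, X_mul_C, ← mul_assoc, ← mul_assoc, h, ← hw k, C_sub,
      C_mul, C_mul]
    abel
  have hdeg : u.natDegree ≤ 1 := by
    rw [hu, add_comm]; exact natDegree_linear_le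
  have hdegp : (u ^ p).natDegree ≤ p := by
    simpa using natDegree_pow_le_of_le p hdeg
  have hp2 := hp.out.two_le
  have hcoeff (n : ℕ) : (u ^ p).coeff (n + 1) * ((n + 1 : ℕ) : A) =
      if n = 0 then w (p - 1) else 0 := by
    have := congrArg (fun q => coeff q n) hd
    simpa [coeff_derivative, coeff_C] using this
  have h0 : (u ^ p).coeff 0 = a ^ p := by
    have h := map_pow (constantCoeff (R := A)) u p
    simpa [hu] using h
  have h1 : (u ^ p).coeff 1 = w (p - 1) := by simpa using hcoeff 0
  -- The derivative does not see this coefficient, since `p = 0` in `A`; it is read off as the top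
  -- coefficient instead.
  have hpp : (u ^ p).coeff p = w 0 ^ p := by
    have := coeff_pow_of_natDegree_le (m := p) hdeg
    simpa [hu] using this
  have hmid (n : ℕ) (hn : 2 ≤ n) (hnp : n < p) : (u ^ p).coeff n = 0 := by
    obtain ⟨k, rfl⟩ : ∃ k, n = k + 1 := ⟨n - 1, by omega⟩
    have h := hcoeff k
    rw [if_neg (by omega)] at h
    have hunit : IsUnit ((k + 1 : ℕ) : A) := (CharP.isUnit_natCast_iff hp.out).mpr
      fun hdvd => absurd (Nat.le_of_dvd k.succ_pos hdvd) (by omega)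
    exact hunit.mul_left_eq_zero.mp h
  have heval : (u ^ p).eval 1 = (a + w 0) ^ p := by
    have h := map_pow (eval₂RingHom' (RingHom.id A) 1 fun x => Commute.one_right x) u p
    have hr (q : A[X]) : eval₂RingHom' (RingHom.id A) 1 (fun x => Commute.one_right x) q =
      q.eval 1 := rfl
    rw [hr, hr] at h
    rw [h, hu]; simp
  rw [← heval, eval_eq_sum_range' (Nat.lt_succ_of_le hdegp), Finset.sum_range_succ, hpp]
  simp only [one_pow, mul_one]
  rw [← Finset.sum_subset (Finset.range_subset_range.mpr hp2) fun n hn hn2 =>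
      hmid n (not_lt.mp (mt Finset.mem_range.mpr hn2)) (Finset.mem_range.mp hn),
    Finset.sum_range_succ, Finset.sum_range_one, h0, h1]
  abel

end CharP

/-! ### The constants of a derivation with minimum polynomial `X ^ p - X` -/

section Constants

variable {K : Type*} [Field K] (p : ℕ) {δ : Derivation ℤ K K}

instance (δ : Derivation ℤ K K) [CharP K p] : CharP (constants δ) p :=
  (constants δ).toSubring.subtype.charP (constants δ).toSubring.subtype_injective p

lemma constLinear_apply (a : K) : constLinear δ a = δ a := rfl

lemma derivation_iterate_prime
    (hδ : minpoly (constants δ) (constLinear δ) = X ^ p - X) (a : K) : δ^[p] a = δ a := by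
  have h := congrArg (fun φ => φ a) (minpoly.aeval (constants δ) (constLinear δ))
  simp only [hδ, map_sub, map_pow, aeval_X, LinearMap.sub_apply, LinearMap.zero_apply,
    sub_eq_zero] at h
  rw [Module.End.pow_apply] at h
  exact h

/-- Write `X^p - X = (X - 1) q`. By minimality `q(δ) ≠ 0`, and every nonzero value of `q(δ)` is an
eigenvector for the eigenvalue `1`. -/
lemma exists_derivation_eq_self [hp : Fact p.Prime]
    (hδ : minpoly (constants δ) (constLinear δ) = X ^ p - X) : ∃ x : K, x ≠ 0 ∧ δ x = x := by
  have hroot : (X ^ p - X : (constants δ)[X]).IsRoot 1 := by simp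
  obtain ⟨q, hq⟩ := dvd_iff_isRoot.mpr hroot
  have hne : (X ^ p - X : (constants δ)[X]) ≠ 0 :=
    FiniteField.X_pow_card_sub_X_ne_zero _ hp.out.one_lt
  have hq0 : q ≠ 0 := by rintro rfl; rw [mul_zero] at hq; exact hne hq
  have hqδ : aeval (constLinear δ) q ≠ 0 := by
    intro h
    have h1 := minpoly.degree_le_of_ne_zero _ _ hq0 h
    rw [hδ, hq, Polynomial.degree_mul, degree_X_sub_C, degree_eq_natDegree hq0] at h1
    have h2 : 1 + q.natDegree ≤ q.natDegree := by exact_mod_cast h1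
    omega
  obtain ⟨y, hy⟩ := DFunLike.ne_iff.mp hqδ
  refine ⟨aeval (constLinear δ) q y, hy, ?_⟩
  have h := congrArg (fun φ => φ y) (minpoly.aeval (constants δ) (constLinear δ))
  simp only [hδ, hq, map_mul, map_sub, aeval_X, Module.End.mul_apply, LinearMap.sub_apply,
    LinearMap.zero_apply, sub_eq_zero, map_one, Module.End.one_apply] at h
  exact h

lemma derivation_pow_of_eq_self {x : K} (hx : δ x = x) (n : ℕ) : δ (x ^ n) = n * x ^ n := by
  induction n with
  | zero => simp
  | succ n ih =>
    rw [pow_succ, Derivation.leibniz, ih, hx]; simp only [smul_eq_mul]; push_cast; ring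

/-- `K` has dimension `p` over the constants: the powers `1, x, …, xᵖ⁻¹` of an `x ≠ 0` with
`δ x = x` form a basis. -/
lemma finrank_constants [hp : Fact p.Prime] [CharP K p]
    (hδ : minpoly (constants δ) (constLinear δ) = X ^ p - X) :
    Module.finrank (constants δ) K = p := by
  obtain ⟨x, hx0, hx⟩ := exists_derivation_eq_self p hδ
  let v : ℕ → constants δ := Nat.cast
  have hv : Set.InjOn v (Finset.range p) := by
    rw [Finset.coe_range]; exact CharP.natCast_injOn_Iio _ p
  -- The powers are eigenvectors of `δ` for the distinct eigenvalues `0, …, p - 1`.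
  have hli : LinearIndependent (constants δ) fun i : Fin p => x ^ (i : ℕ) := by
    refine Module.End.eigenvectors_linearIndependent' (constLinear δ) (fun i : Fin p => v i)
      (fun i j hij => Fin.ext (hv (by simp) (by simp) hij)) _ fun i => ?_
    refine ⟨Module.End.mem_eigenspace_iff.mpr ?_, pow_ne_zero _ hx0⟩
    rw [constLinear_apply, derivation_pow_of_eq_self hx]
    rfl
  -- Both sides are monic of degree `p` and vanish at the `p` elements of the prime field.
  have hnodal : Lagrange.nodal (Finset.range p) v = X ^ p - X := by
    have hdeg : (X ^ p - X : (constants δ)[X]).degree = p := by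
      rw [degree_eq_natDegree (FiniteField.X_pow_card_sub_X_ne_zero _ hp.out.one_lt),
        FiniteField.X_pow_card_sub_X_natDegree_eq _ hp.out.one_lt]
    refine Polynomial.eq_of_degree_le_of_eval_index_eq (Finset.range p) hv ?_ ?_ ?_ ?_
    · simp
    · simp [hdeg]
    · rw [Lagrange.nodal_monic.leadingCoeff]
      exact (monic_X_pow_sub (by rw [degree_X]; exact_mod_cast hp.out.one_lt)).leadingCoeff.symm
    · intro i hi
      rw [Lagrange.eval_nodal_at_node hi]
      simp only [v, eval_sub, eval_pow, eval_X]
      rw [← frobenius_def, map_natCast, sub_self]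
  have hspan : ⊤ ≤ Submodule.span (constants δ) (Set.range fun i : Fin p => x ^ (i : ℕ)) := by
    intro y _
    -- The Lagrange basis sums to `1`; applied to `δ`, it splits `y` into its eigencomponents.
    have hsum := congrArg (fun q => aeval (constLinear δ) q y)
      (Lagrange.sum_basis hv ⟨0, by simpa using hp.out.pos⟩)
    simp only [map_sum, LinearMap.sum_apply, map_one, Module.End.one_apply] at hsum
    rw [← hsum]
    refine Submodule.sum_mem _ fun i hi => ?_
    set z := aeval (constLinear δ) (Lagrange.basis (Finset.range p) v i) y with hz
    have hδz : δ z = i * z := by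
      have h : aeval (constLinear δ)
          ((X - C (v i)) * Lagrange.basis (Finset.range p) v i) y = 0 := by
        rw [Lagrange.basis_eq_prod_sub_inv_mul_nodal_div hi, mul_left_comm,
          ← Lagrange.nodal_erase_eq_nodal_div hi, ← Lagrange.nodal_eq_mul_nodal_erase hi, hnodal,
          ← hδ, map_mul, minpoly.aeval, mul_zero, LinearMap.zero_apply]
      rw [map_mul, Module.End.mul_apply, ← hz] at h
      simp only [map_sub, aeval_X, aeval_C, LinearMap.sub_apply, sub_eq_zero,
        Module.algebraMap_end_apply] at h
      exact h
    have hxi : x ^ i ≠ 0 := pow_ne_zero _ hx0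
    -- Two eigenvectors with the same eigenvalue have a constant quotient, so each eigenspace is a
    -- line over the constants.
    have hmem : z / x ^ i ∈ constants δ := by
      change δ (z / x ^ i) = 0
      rw [Derivation.leibniz_div, hδz, derivation_pow_of_eq_self hx]
      simp only [smul_eq_mul]
      ring
    have hzx : z = (⟨z / x ^ i, hmem⟩ : constants δ) • x ^ i := by
      change z = z / x ^ i * x ^ i
      rw [div_mul_cancel₀ _ hxi]
    rw [hzx]
    exact Submodule.smul_mem _ _ (Submodule.subset_span ⟨⟨i, by simpa using hi⟩, rfl⟩)
  rw [Module.finrank_eq_card_basis (Module.Basis.mk hli hspan), Fintype.card_fin]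

end Constants

/-! ### Substitutions and coefficients in the differential polynomial ring -/

namespace DiffPoly

variable {K : Type*} [Field K] {δ : Derivation ℤ K K}

lemma const_zero : (const 0 : DiffPoly δ) = 0 := toPoly.injective <| by simp [toPoly_const]

lemma const_one : (const 1 : DiffPoly δ) = 1 := toPoly.injective <| by
  simp [toPoly_const, toPoly_one]

lemma const_eq_smul_one (a : K) : (const a : DiffPoly δ) = a • 1 := by
  rw [← const_mul, mul_one]

variable (δ) in
/-- The inclusion of the constant polynomials, as a ring homomorphism. -/
def constHom : K →+* DiffPoly δ where
  toFun := const
  map_one' := const_one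
  map_zero' := const_zero
  map_mul' a b := by rw [const_mul, const_eq_smul_one, const_eq_smul_one, mul_smul]
  map_add' a b := by simp only [const_eq_smul_one, add_smul]

lemma constHom_apply (a : K) : constHom δ a = const a := rfl

instance (p : ℕ) [CharP K p] : CharP (DiffPoly δ) p :=
  charP_of_injective_ringHom (f := constHom δ)
    (fun _ _ h => C_injective (congrArg toPoly h)) p

lemma degree_lt_iff {g : DiffPoly δ} {n : ℕ} :
    g.degree < n ↔ ∀ k, n ≤ k → (toPoly g).coeff k = 0 :=
  degree_lt_iff_coeff_zero _ _

lemma degree_zero : (0 : DiffPoly δ).degree = ⊥ := by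
  rw [degree, map_zero, Polynomial.degree_zero]

lemma degree_t : (t : DiffPoly δ).degree = 1 := degree_X

lemma degree_const_le (a : K) : (const a : DiffPoly δ).degree ≤ 0 := degree_C_le

lemma eq_sum (g : DiffPoly δ) : g = (toPoly g).sum fun i a => const a * t ^ i := by
  apply toPoly.injective
  conv_lhs => rw [← sum_C_mul_X_pow_eq (toPoly g)]
  simp only [Polynomial.sum, map_sum, const_mul, map_smul, toPoly_t_pow, smul_eq_C_mul]

lemma induction_on {P : DiffPoly δ → Prop} (g : DiffPoly δ)
    (hadd : ∀ x y, P x → P y → P (x + y)) (hmon : ∀ i a, P (const a * t ^ i)) : P g := by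
  rw [eq_sum g]
  refine Finset.sum_induction _ P hadd ?_ fun i _ => hmon i _
  simpa [const_zero] using hmon 0 0

lemma substMap_add (τ : K ≃+* K) (a : K) (g h : DiffPoly δ) :
    substMap δ τ a (g + h) = substMap δ τ a g + substMap δ τ a h := by
  rw [substMap, map_add, sum_add_index]
  · rfl
  · simp [const_zero]
  · intro i b c
    simp only [← constHom_apply, map_add, add_mul]

lemma substMap_const_mul_pow (τ : K ≃+* K) (a b : K) (i : ℕ) :
    substMap δ τ a (const b * t ^ i) = const (τ b) * (t + const a) ^ i := by
  rw [substMap, const_mul, map_smul, toPoly_t_pow, X_pow_eq_monomial, smul_monomial, smul_eq_mul,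
    mul_one, sum_monomial_index]
  simp [const_zero]

lemma add_const_mul_const (a b : K) :
    ((t : DiffPoly δ) + const a) * const b = const b * (t + const a) + const (δ b) := by
  have h : (const a : DiffPoly δ) * const b = const b * const a := by
    simp only [← constHom_apply, ← map_mul, mul_comm]
  rw [add_mul, mul_add, t_mul_const, h]
  abel

/-- As `K` is commutative, `t + a` obeys the same commutation rule with constants as `t`
(`add_const_mul_const`). Multiplicativity therefore reduces to left multiplication by `t` and by
constants. -/
lemma substMap_mul (a : K) (g h : DiffPoly δ) :
    substMap δ (RingEquiv.refl K) a (g * h) =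
      substMap δ (RingEquiv.refl K) a g * substMap δ (RingEquiv.refl K) a h := by
  have ht (h : DiffPoly δ) : substMap δ (RingEquiv.refl K) a (t * h) =
      (t + const a) * substMap δ (RingEquiv.refl K) a h := by
    induction h using induction_on with
    | hadd x y hx hy => rw [mul_add, substMap_add, hx, hy, substMap_add, mul_add]
    | hmon i b =>
      rw [← mul_assoc, t_mul_const, add_mul, mul_assoc, ← pow_succ', substMap_add,
        substMap_const_mul_pow, substMap_const_mul_pow, substMap_const_mul_pow, ← mul_assoc]
      simp only [RingEquiv.refl_apply]
      rw [add_const_mul_const, add_mul, mul_assoc, ← pow_succ']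
  have hpow (i : ℕ) (h : DiffPoly δ) : substMap δ (RingEquiv.refl K) a (t ^ i * h) =
      (t + const a) ^ i * substMap δ (RingEquiv.refl K) a h := by
    induction i with
    | zero => simp
    | succ i ih => rw [pow_succ', mul_assoc, ht, ih, pow_succ', mul_assoc]
  have hconst (b : K) (h : DiffPoly δ) : substMap δ (RingEquiv.refl K) a (const b * h) =
      const b * substMap δ (RingEquiv.refl K) a h := by
    induction h using induction_on with
    | hadd x y hx hy => rw [mul_add, substMap_add, hx, hy, substMap_add, mul_add]
    | hmon i c =>
      have hmul (x y : K) : (const x * const y : DiffPoly δ) = const (x * y) :=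
        ((constHom δ).map_mul x y).symm
      rw [← mul_assoc, hmul, substMap_const_mul_pow, substMap_const_mul_pow, ← mul_assoc]
      simp only [RingEquiv.refl_apply, hmul]
  induction g using induction_on with
  | hadd x y hx hy => rw [add_mul, substMap_add, hx, hy, substMap_add, add_mul]
  | hmon i b =>
    rw [mul_assoc, hconst, hpow, substMap_const_mul_pow, mul_assoc, RingEquiv.refl_apply]

variable (δ) in
/-- The ring endomorphism `∑ aᵢ tⁱ ↦ ∑ aᵢ (t + a)ⁱ` of `K[t;δ]`. -/
def shift (a : K) : DiffPoly δ →+* DiffPoly δ where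
  toFun := substMap δ (RingEquiv.refl K) a
  map_one' := by simpa [const_one] using substMap_const_mul_pow (δ := δ) (RingEquiv.refl K) a 1 0
  map_mul' := substMap_mul a
  map_zero' := by simpa [const_zero] using substMap_const_mul_pow (δ := δ) (RingEquiv.refl K) a 0 0
  map_add' := substMap_add _ a

lemma shift_apply (a : K) (g : DiffPoly δ) :
    shift δ a g = substMap δ (RingEquiv.refl K) a g := rfl

lemma shift_const (a b : K) : shift δ a (const b) = const b := by
  simpa [shift_apply] using substMap_const_mul_pow (δ := δ) (RingEquiv.refl K) a b 0

lemma shift_t (a : K) : shift δ a t = t + const a := by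
  simpa [shift_apply, const_one] using substMap_const_mul_pow (δ := δ) (RingEquiv.refl K) a 1 1

lemma shift_smul (a b : K) (g : DiffPoly δ) : shift δ a (b • g) = b • shift δ a g := by
  rw [← const_mul, map_mul, shift_const, const_mul]

lemma shift_iterate_t (a : K) (n : ℕ) : (shift δ a)^[n] t = t + (n : DiffPoly δ) * const a := by
  induction n with
  | zero => simp
  | succ n ih =>
    rw [Function.iterate_succ_apply', ih, map_add, map_mul, map_natCast, shift_const, shift_t]
    push_cast
    rw [add_mul, one_mul]; abel

lemma shift_iterate_char (p : ℕ) [CharP K p] (a : K) (g : DiffPoly δ) :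
    (shift δ a)^[p] g = g := by
  have hc (n : ℕ) (b : K) : (shift δ a)^[n] (const b) = const b :=
    Function.iterate_fixed (shift_const a b) n
  induction g using induction_on with
  | hadd x y hx hy => rw [iterate_map_add, hx, hy]
  | hmon i b =>
    rw [iterate_map_mul, hc, iterate_map_pow, shift_iterate_t, CharP.cast_eq_zero, zero_mul,
      add_zero]

lemma degree_shift_lt {a : K} {g : DiffPoly δ} {n : ℕ} (hg : g.degree < n) :
    (shift δ a g).degree < n := by
  have hlin : (t + const a : DiffPoly δ).degree ≤ 1 :=
    (Polynomial.degree_add_le _ _).trans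
      (max_le (degree_t (δ := δ)).le ((degree_const_le (δ := δ) a).trans zero_le_one))
  have hpow (i : ℕ) : ((t + const a : DiffPoly δ) ^ i).degree ≤ i := by
    induction i with
    | zero => rw [pow_zero, ← const_one]; exact degree_const_le 1
    | succ i ih => rw [pow_succ, degree_mul]; push_cast; gcongr
  change (toPoly (∑ i ∈ (toPoly g).support, _)).degree < _
  rw [map_sum]
  refine (degree_sum_le _ _).trans_lt
    ((Finset.sup_lt_iff (WithBot.bot_lt_coe n)).mpr fun i hi => ?_)
  change (const _ * (t + const a) ^ i : DiffPoly δ).degree < _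
  rw [degree_mul]
  refine (add_le_add (degree_const_le _) (hpow i)).trans_lt ?_
  rw [zero_add]
  exact (le_degree_of_mem_supp i hi).trans_lt hg

/-! ### Powers in characteristic `p` -/

section CharP

variable (p : ℕ) [hp : Fact p.Prime] [CharP K p]

/-- Jacobson's formula applies to `t + (-z)`: the iterated commutators are the constants `-δ^k z`,
which commute with each other. -/
lemma t_sub_const_pow_char (z : K) :
    ((t : DiffPoly δ) - const z) ^ p = t ^ p - const (z ^ p + δ^[p - 1] z) := by
  have hcomm (a b : K) : Commute (const a : DiffPoly δ) (const b) := by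
    simp only [← constHom_apply]; exact (Commute.all a b).map (constHom δ)
  have h := add_pow_char_of_commute_commutators p (t : DiffPoly δ)
    (fun k => const (-δ^[k] z)) (fun k => ?_) (fun k => hcomm _ _)
  · have hneg (a : K) : (const (-a) : DiffPoly δ) = -const a := (constHom δ).map_neg a
    have hpow : (const z : DiffPoly δ) ^ p = const (z ^ p) := ((constHom δ).map_pow z p).symm
    have hadd (a b : K) : (const (a + b) : DiffPoly δ) = const a + const b :=
      (constHom δ).map_add a b
    -- Expanding `(0 - z)^p` covers odd `p` and `p = 2` uniformly.
    have hnp : (-const z : DiffPoly δ) ^ p = -const (z ^ p) := by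
      have := sub_pow_char_of_commute (p := p) (Commute.zero_left (const z : DiffPoly δ))
      rwa [zero_sub, zero_pow hp.out.ne_zero, zero_sub, hpow] at this
    simp only [Function.iterate_zero_apply, hneg, hnp] at h
    rw [sub_eq_add_neg, h, hadd]
    abel
  · rw [t_mul_const, add_sub_cancel_left, Function.iterate_succ_apply', map_neg]

lemma vMap_eq (z : K) : vMap δ p z = z ^ p + δ^[p - 1] z := by
  rw [vMap, t_sub_const_pow_char, sub_sub_cancel, toPoly_const, coeff_C_zero]

lemma shift_cyclicPoly (d : K) : shift δ (-1) (cyclicPoly δ p d) = cyclicPoly δ p d := by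
  have h1 : (const (-1) : DiffPoly δ) = -1 := by
    rw [← constHom_apply, map_neg, map_one]
  rw [cyclicPoly, map_sub, map_sub, map_pow, shift_t, shift_const, h1, ← sub_eq_add_neg,
    sub_pow_char_of_commute p (Commute.one_right t), one_pow]
  abel

lemma t_pow_char_mul_const (a : K) :
    (t : DiffPoly δ) ^ p * const a = const a * t ^ p + const (δ^[p] a) := by
  have h := pow_char_mul_sub_mul_pow_char p (t : DiffPoly δ) (fun k => const (δ^[k] a)) fun k => by
    rw [t_mul_const, add_sub_cancel_left, Function.iterate_succ_apply']
  exact eq_add_of_sub_eq' h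

end CharP

/-! ### Leading coefficients of commutators with constants -/

lemma coeff_succ_tMul (q : K[X]) (k : ℕ) :
    (tMul δ q).coeff (k + 1) = q.coeff k + δ (q.coeff (k + 1)) := by
  have h (n : ℕ) : (coeffDeriv δ q).coeff n = δ (q.coeff n) := by
    induction q using Polynomial.induction_on' with
    | add x y hx hy => rw [map_add, coeff_add, hx, hy, coeff_add, map_add]
    | monomial j b =>
      rw [coeffDeriv_monomial, coeff_monomial, coeff_monomial]; split_ifs <;> simp
  rw [tMul_apply, coeff_add, coeff_X_mul, h]

lemma coeff_tMul_iterate_C_of_lt (a : K) {n k : ℕ} (h : n < k) :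
    ((tMul δ)^[n] (C a)).coeff k = 0 := by
  apply coeff_eq_zero_of_degree_lt
  rw [degree_tMul_iterate]
  calc (C a).degree + n ≤ 0 + n := by gcongr; exact degree_C_le
    _ < k := by rw [zero_add]; exact_mod_cast h

lemma coeff_self_tMul_iterate_C (a : K) (n : ℕ) : ((tMul δ)^[n] (C a)).coeff n = a := by
  induction n with
  | zero => simp
  | succ n ih =>
    rw [Function.iterate_succ_apply', coeff_succ_tMul, ih,
      coeff_tMul_iterate_C_of_lt a n.lt_succ_self, map_zero, add_zero]

/-- The second term of `tⁿ⁺¹ a = a tⁿ⁺¹ + (n + 1) δ(a) tⁿ + ⋯`; the descent on degrees rests on it.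
-/
lemma coeff_tMul_iterate_succ_C (a : K) (n : ℕ) :
    ((tMul δ)^[n + 1] (C a)).coeff n = (n + 1 : ℕ) * δ a := by
  induction n with
  | zero =>
    rw [Function.iterate_one, ← monomial_zero_left, tMul_monomial]; simp [coeff_monomial]
  | succ n ih =>
    rw [Function.iterate_succ_apply', coeff_succ_tMul, ih, coeff_self_tMul_iterate_C]
    push_cast; ring

lemma coeff_mul_const (a : K) {g : DiffPoly δ} {m : ℕ} (hg : g.degree < (m + 2 : ℕ)) :
    (toPoly (g * const a)).coeff (m + 1) = (toPoly g).coeff (m + 1) * a ∧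
    (toPoly (g * const a)).coeff m =
      (toPoly g).coeff m * a + (toPoly g).coeff (m + 1) * ((m + 1 : ℕ) * δ a) := by
  have hnat : (toPoly g).natDegree < m + 2 := by
    rcases eq_or_ne (toPoly g) 0 with h | h
    · rw [h]; simp
    · exact (natDegree_lt_iff_degree_lt h).mpr hg
  have hsum : toPoly (g * const a) =
      ∑ i ∈ Finset.range (m + 2), (toPoly g).coeff i • (tMul δ)^[i] (C a) := by
    rw [toPoly_mul, toPoly_const]
    exact sum_over_range' (f := fun i c => c • (tMul δ)^[i] (C a)) _ (fun _ => zero_smul K _) _ hnat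
  have hlow (k : ℕ) (hk : m ≤ k) :
      (∑ i ∈ Finset.range m, (toPoly g).coeff i • (tMul δ)^[i] (C a)).coeff k = 0 := by
    rw [finsetSum_coeff]
    refine Finset.sum_eq_zero fun i hi => ?_
    rw [coeff_smul, coeff_tMul_iterate_C_of_lt a ((Finset.mem_range.mp hi).trans_le hk), smul_zero]
  rw [hsum, Finset.sum_range_succ, Finset.sum_range_succ]
  constructor
  · rw [coeff_add, coeff_add, hlow _ m.le_succ, coeff_smul, coeff_smul, coeff_self_tMul_iterate_C,
      coeff_tMul_iterate_C_of_lt a m.lt_succ_self]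
    simp
  · rw [coeff_add, coeff_add, hlow _ le_rfl, coeff_smul, coeff_smul, coeff_self_tMul_iterate_C,
      coeff_tMul_iterate_succ_C]
    simp

/-- The commutator of a polynomial of degree `m + 1` with a constant `a` has degree at most `m`,
and its coefficient of `tᵐ` is known. -/
lemma commutator_const (a : K) {g : DiffPoly δ} {m : ℕ} (hg : g.degree < (m + 2 : ℕ)) :
    (g * const a - const a * g).degree < ((m + 1 : ℕ) : WithBot ℕ) ∧
    (toPoly (g * const a - const a * g)).coeff m =
      (toPoly g).coeff (m + 1) * ((m + 1 : ℕ) * δ a) := by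
  obtain ⟨h1, h2⟩ := coeff_mul_const a hg
  have hdeg : (g * const a).degree ≤ g.degree := by
    rw [degree_mul]
    calc g.degree + (const a : DiffPoly δ).degree ≤ g.degree + 0 := by
          gcongr; exact degree_const_le a
      _ = g.degree := add_zero _
  constructor
  · rw [degree_lt_iff]
    intro k hk
    rw [map_sub, coeff_sub, const_mul, map_smul, coeff_smul, smul_eq_mul]
    rcases hk.eq_or_lt with rfl | hk
    · rw [h1]; ring
    · rw [degree_lt_iff.mp (hdeg.trans_lt hg) k hk, degree_lt_iff.mp hg k hk]; simp
  · rw [map_sub, coeff_sub, const_mul, map_smul, coeff_smul, smul_eq_mul, h2]; ring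

/-- A `K`-subspace of `K[t;δ]` that is closed under right multiplication by a nonconstant `x ∈ K`
contains `1` as soon as it contains a nonzero element of degree less than `p`. -/
lemma one_mem_of_mul_const_mem (p : ℕ) [CharP K p] (S : Submodule K (DiffPoly δ)) {x : K}
    (hx : δ x ≠ 0) (hS : ∀ g ∈ S, g.degree < p → g * const x ∈ S) {g : DiffPoly δ} (hg : g ∈ S)
    (hg0 : g ≠ 0) (hgp : g.degree < p) : 1 ∈ S := by
  have hne {g : DiffPoly δ} (h : g ≠ 0) : toPoly g ≠ 0 := by
    rwa [Ne, EmbeddingLike.map_eq_zero_iff]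
  induction hn : (toPoly g).natDegree using Nat.strong_induction_on generalizing g with
  | _ n ih =>
    have hgd : g.degree = n := by rw [degree, degree_eq_natDegree (hne hg0), hn]
    rcases n with _ | m
    · obtain ⟨c, hc⟩ := natDegree_eq_zero.mp hn
      have hgc : g = c • 1 := by
        rw [← const_eq_smul_one]; exact toPoly.injective (hc.symm.trans (toPoly_const c).symm)
      have hc0 : c ≠ 0 := by rintro rfl; exact hg0 (by rw [hgc, zero_smul])
      rw [← inv_smul_smul₀ hc0 (1 : DiffPoly δ), ← hgc]
      exact S.smul_mem _ hg
    · have hmp : m + 1 < p := by rw [hgd] at hgp; exact_mod_cast hgp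
      obtain ⟨h1, h2⟩ := commutator_const x (g := g) (m := m)
        (by rw [hgd]; exact_mod_cast Nat.lt_succ_self _)
      -- The new leading coefficient is `(m + 1) δ(x)` times the old one, and `m + 1 < p` keeps it
      -- nonzero. So the degree falls by exactly one, and the descent ends at a nonzero constant.
      have hcoeff : (toPoly (g * const x - const x * g)).coeff m ≠ 0 := by
        rw [h2]
        refine mul_ne_zero ?_ (mul_ne_zero ?_ hx)
        · rw [← hn]; exact leadingCoeff_ne_zero.mpr (hne hg0)
        · rw [Ne, CharP.cast_eq_zero_iff K p]
          exact fun hdvd => absurd (Nat.le_of_dvd m.succ_pos hdvd) (by omega)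
      have h0 : g * const x - const x * g ≠ 0 := by
        intro h; rw [h, map_zero, coeff_zero] at hcoeff; exact hcoeff rfl
      refine ih _ ((natDegree_lt_iff_degree_lt (hne h0)).mpr h1) ?_ h0
        (h1.trans (by exact_mod_cast hmp)) rfl
      rw [const_mul]
      exact S.sub_mem (hS g hg hgp) (S.smul_mem _ hg)

/-! ### Central elements of the differential polynomial ring. -/

lemma commute_of_commute_t_of_commute_const {c : DiffPoly δ} (ht : Commute c t)
    (hK : ∀ a, Commute c (const a)) (g : DiffPoly δ) : Commute c g := by
  induction g using induction_on with
  | hadd x y hx hy => exact hx.add_right hy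
  | hmon i a => exact (hK a).mul_right (ht.pow_right i)

/-- The polynomial `tᵖ - t` is central when `δᵖ = δ`. -/
lemma commute_t_pow_sub_t (p : ℕ) [Fact p.Prime] [CharP K p] (hδ : ∀ a, δ^[p] a = δ a)
    (g : DiffPoly δ) : Commute (t ^ p - t) g := by
  refine commute_of_commute_t_of_commute_const
    (((Commute.refl t).pow_left p).sub_left (Commute.refl t)) (fun a => ?_) g
  rw [commute_iff_eq, sub_mul, mul_sub, t_pow_char_mul_const, t_mul_const, hδ]
  abel

lemma commute_cyclicPoly (p : ℕ) [Fact p.Prime] [CharP K p] (hδ : ∀ a, δ^[p] a = δ a) {d : K}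
    (hd : δ d = 0) (g : DiffPoly δ) : Commute (cyclicPoly δ p d) g := by
  refine (commute_t_pow_sub_t p hδ g).sub_left ?_
  rw [commute_iff_eq, const_mul, const_eq_smul_one, mul_smul_of_mem hd, mul_one]

end DiffPoly

/-! ### Dimensions and zero divisors of Petit algebras -/

namespace PetitAlgebra

open DiffPoly

variable {K : Type*} [Field K] {δ : Derivation ℤ K K} {f : DiffPoly δ} {hf : 0 < f.degree}

lemma val_ofField (a : K) : val (ofField a : PetitAlgebra f hf) = const a := rfl

lemma modr_mul_self (g : DiffPoly δ) : modr f hf (g * f) = 0 :=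
  modr_eq hf (q := g) (by rw [DiffPoly.degree_zero]; exact bot_le.trans_lt hf) (add_zero _).symm

lemma modr_self : modr f hf f = 0 := by
  simpa only [one_mul] using modr_mul_self (hf := hf) 1

lemma modr_mul_modr (g h : DiffPoly δ) : modr f hf (g * modr f hf h) = modr f hf (g * h) := by
  obtain ⟨q, hq⟩ := exists_eq_mul_add_modr f hf h
  conv_rhs => rw [hq, mul_add, ← mul_assoc, modr_add, modr_mul_self, zero_add]

/-- The multiples `q f` form only a left ideal in general. Reducing the left factor is harmless here
because `f` moves past `h`; this is what makes `S_f` associative. -/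
lemma modr_modr_mul (hcomm : ∀ g, Commute f g) (g h : DiffPoly δ) :
    modr f hf (modr f hf g * h) = modr f hf (g * h) := by
  obtain ⟨q, hq⟩ := exists_eq_mul_add_modr f hf g
  conv_rhs =>
    rw [hq, add_mul, mul_assoc, (hcomm h).eq, ← mul_assoc, modr_add, modr_mul_self, zero_add]

lemma finrank_field {n : ℕ} (hn : f.degree = n) : Module.finrank K (PetitAlgebra f hf) = n := by
  have hmap : (lowDegree f hf).map (toPoly (δ := δ)).toLinearMap = degreeLT K n := by
    ext q
    rw [mem_degreeLT, ← hn]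
    constructor
    · rintro ⟨g, hg, rfl⟩; exact hg
    · intro hq; exact ⟨ofPoly q, hq, rfl⟩
  have e : PetitAlgebra f hf ≃ₗ[K] (Fin n → K) :=
    ((toPoly (δ := δ)).submoduleMap (lowDegree f hf)).trans
      ((LinearEquiv.ofEq _ _ hmap).trans (degreeLTEquiv K n))
  rw [e.finrank_eq, Module.finrank_fin_fun]

lemma finite_field : Module.Finite K (PetitAlgebra f hf) := by
  have h : f.degree = ((toPoly f).natDegree : ℕ) := degree_eq_natDegree <| by
    intro h0
    rw [DiffPoly.degree, h0, Polynomial.degree_zero] at hf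
    exact not_lt_bot hf
  refine Module.finite_of_finrank_pos ?_
  rw [finrank_field h]
  rw [h] at hf
  exact_mod_cast hf

lemma finrank_constants_eq_mul {n : ℕ} (hn : f.degree = n) :
    Module.finrank (constants δ) (PetitAlgebra f hf) = Module.finrank (constants δ) K * n := by
  rw [← Module.finrank_mul_finrank (constants δ) K (PetitAlgebra f hf), finrank_field hn]

instance : Nontrivial (PetitAlgebra f hf) := by
  refine ⟨⟨1, 0, fun h => ?_⟩⟩
  have h1 := congrArg val h
  rw [val_one, map_zero] at h1
  have h2 := congrArg toPoly h1
  rw [toPoly_one, map_zero] at h2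
  exact one_ne_zero h2

lemma isDivisionAlgebra [Module.Finite (constants δ) (PetitAlgebra f hf)]
    (h : ∀ a b : PetitAlgebra f hf, a * b = 0 → a = 0 ∨ b = 0) :
    IsDivisionAlgebra (PetitAlgebra f hf) := by
  refine ⟨inferInstance, fun a ha => ⟨?_, ?_⟩⟩
  · have hinj : Function.Injective (LinearMap.mulLeft (constants δ) a) := by
      rw [injective_iff_map_eq_zero]
      exact fun x hx => (h a x hx).resolve_left ha
    exact ⟨hinj, LinearMap.injective_iff_surjective.mp hinj⟩
  · have hinj : Function.Injective (LinearMap.mulRight (constants δ) a) := by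
      rw [injective_iff_map_eq_zero]
      exact fun x hx => (h x a hx).resolve_right ha
    exact ⟨hinj, LinearMap.injective_iff_surjective.mp hinj⟩

/-- If `b` has a left inverse modulo `K[t;δ] f`, then `b` is not a right zero divisor in `S_f`. -/
lemma eq_zero_of_mul_eq_zero {a b : PetitAlgebra f hf} {u v : DiffPoly δ}
    (huv : u * val b + v * f = 1) (hab : a * b = 0) : a = 0 := by
  by_contra ha
  have := finite_field (f := f) (hf := hf)
  let ρ : PetitAlgebra f hf →ₗ[K] PetitAlgebra f hf :=
    { toFun := fun x => x * b
      map_add' := fun x y => add_mul x y b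
      map_smul' := fun c x => val_injective <| by
        rw [val_mul, map_smul, smul_mul, modr_smul, RingHom.id_apply, map_smul, val_mul] }
  have hab' : modr f hf (val a * val b) = 0 := by rw [← val_mul, hab, map_zero]
  have hsurj : Function.Surjective ρ := by
    intro x
    -- The remainder `r` of `x u` under division by `a` will be a preimage of `x`. A constant `a` is
    -- a unit, so the remainder `0` serves there.
    have hdiv : ∃ q r : DiffPoly δ, r.degree < f.degree ∧ val x * u = q * val a + r := by
      rcases lt_or_ge 0 (val a).degree with h0 | h0
      · obtain ⟨q, r, hr, hq⟩ := exists_eq_mul_add (val a) h0 (val x * u)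
        exact ⟨q, r, hr.trans (degree_val_lt a), hq⟩
      · have hc := eq_C_of_degree_le_zero h0
        set c := (toPoly (val a)).coeff 0
        have hac : val a = const c := toPoly.injective (hc.trans (toPoly_const c).symm)
        have hc0 : c ≠ 0 := by
          intro h
          rw [h, const_zero] at hac
          exact ha (val_injective (hac.trans (map_zero _).symm))
        refine ⟨val x * u * const c⁻¹, 0, ?_, ?_⟩
        · rw [DiffPoly.degree_zero]; exact bot_le.trans_lt hf
        · rw [hac, mul_assoc _ (const c⁻¹), ← constHom_apply, ← constHom_apply, ← map_mul,
            inv_mul_cancel₀ hc0, map_one, mul_one, add_zero]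
    obtain ⟨q, r, hr, hq⟩ := hdiv
    refine ⟨mk r hr, val_injective ?_⟩
    change modr f hf (r * val b) = val x
    -- Multiply `u b + v f = 1` by `x` on the left. Modulo `f` the first term dies because `a b`
    -- does, leaving `x = r ∘ b`; a surjective `K`-linear endomorphism of finite dimension is
    -- injective.
    have hx : val x = q * (val a * val b) + r * val b + val x * v * f := by
      rw [← mul_assoc, ← add_mul, ← hq, mul_assoc, mul_assoc, ← mul_add, huv, mul_one]
    rw [← modr_of_lt hf (degree_val_lt x)]
    conv_rhs => rw [hx, modr_add, modr_add, modr_mul_self, add_zero, ← modr_mul_modr, hab',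
      mul_zero, modr_zero, zero_add]
  exact ha (LinearMap.injective_iff_surjective.mpr hsurj
    (show a * b = 0 * b by rw [hab, zero_mul]))

/-- The ring structure of `S_f` for a central `f`. -/
abbrev ringOfCommute (hcomm : ∀ g, Commute f g) : Ring (PetitAlgebra f hf) where
  __ := (inferInstance : NonAssocRing (PetitAlgebra f hf))
  mul_assoc a b c := val_injective <| by
    rw [val_mul, val_mul, val_mul, val_mul, modr_modr_mul hcomm, modr_mul_modr, mul_assoc]

/-- The algebra structure of `S_f` over the constants for a central `f`. -/
abbrev algebraOfCommute (hcomm : ∀ g, Commute f g) :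
    letI := ringOfCommute (hf := hf) hcomm
    Algebra (constants δ) (PetitAlgebra f hf) :=
  letI := ringOfCommute (hf := hf) hcomm
  Algebra.ofModule smul_mul_assoc mul_smul_comm

/-- The projection of `K[t;δ]` onto `S_f` for a central `f`. -/
def projOfCommute (hcomm : ∀ g, Commute f g) :
    letI := ringOfCommute (hf := hf) hcomm
    DiffPoly δ →+* PetitAlgebra f hf :=
  letI := ringOfCommute (hf := hf) hcomm
  { toFun := fun g => mk (modr f hf g) (degree_modr_lt f hf g)
    map_one' := val_injective <| by
      rw [val_mk, ← val_one (f := f) (hf := hf), modr_of_lt hf (degree_val_lt 1)]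
    map_mul' := fun g h => val_injective <| by
      rw [val_mk]
      change _ = modr f hf (modr f hf g * modr f hf h)
      rw [modr_modr_mul hcomm, modr_mul_modr]
    map_zero' := val_injective <| by rw [val_mk, modr_zero, map_zero]
    map_add' := fun g h => val_injective <| by rw [map_add, val_mk, val_mk, val_mk, modr_add] }

end PetitAlgebra

/-! ### The algebra `(K, δ, d)` -/

namespace CyclicExt

open DiffPoly PetitAlgebra

variable {K : Type*} [Field K] (p : ℕ) [hp : Fact p.Prime] {δ : Derivation ℤ K K}

variable (δ) in
/-- The map `∑ aᵢ tⁱ ↦ ∑ aᵢ (t - 1)ⁱ` of `(K, δ, d)` to itself. -/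
def shiftLinear (d : K) : CyclicExt δ p d →ₗ[constants δ] CyclicExt δ p d where
  toFun x := mk (shift δ (-1) (val x)) (by
    have hx := degree_val_lt x
    rw [degree_cyclicPoly] at hx ⊢
    exact degree_shift_lt hx)
  map_add' x y := val_injective <| by simp only [map_add, val_mk]
  map_smul' c x := val_injective (shift_smul (-1) (c : K) (val x))

lemma val_shiftLinear {d : K} (x : CyclicExt δ p d) :
    val (shiftLinear p δ d x) = shift δ (-1) (val x) := rfl

variable [CharP K p]

lemma finrank_constants (hδ : minpoly (constants δ) (constLinear δ) = X ^ p - X) (d : K) :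
    Module.finrank (constants δ) (CyclicExt δ p d) = p ^ 2 := by
  rw [finrank_constants_eq_mul (degree_cyclicPoly δ p d), _root_.finrank_constants p hδ, sq]

/-! ### Zero divisors of `(K, δ, d)` and right factors `t - z`. -/

lemma eq_zero_of_mul_eq_zero_of_derivation_ne_zero (hδ : ∀ a, δ^[p] a = δ a) {d : K}
    (hd : δ d ≠ 0) {a b : CyclicExt δ p d} (hab : a * b = 0) (hb : b ≠ 0) : a = 0 := by
  set f := cyclicPoly δ p d with hf
  have hmem (g : DiffPoly δ) : g ∈ Submodule.span (DiffPoly δ) {val b, f} ↔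
      ∃ u v, u * val b + v * f = g := by
    simp [Submodule.mem_span_pair]
  let S : Submodule K (DiffPoly δ) :=
    { carrier := Submodule.span (DiffPoly δ) {val b, f}
      zero_mem' := Submodule.zero_mem _
      add_mem' := Submodule.add_mem _
      smul_mem' := fun c g hg => by
        rw [← const_mul]; exact Submodule.smul_mem _ (const c) hg }
  have hfS : f ∈ S := Submodule.subset_span (by simp)
  have hbS : val b ∈ S := Submodule.subset_span (by simp)
  have hmul (u g : DiffPoly δ) (hg : g ∈ S) : u * g ∈ S := Submodule.smul_mem _ u hg
  have hone : (1 : DiffPoly δ) ∈ S := by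
    refine one_mem_of_mul_const_mem p S hd (fun g hg _ => ?_) hbS
      (fun h => hb (val_injective (h.trans (map_zero _).symm)))
      (by rw [← degree_cyclicPoly δ p d]; exact degree_val_lt b)
    -- Centrality of `t^p - t` lets `d = (t^p - t) - f` act on the right without leaving the left
    -- ideal, so the descent can use commutators with `d`.
    have hgd : g * const d = (t ^ p - t) * g - g * f := by
      rw [(commute_t_pow_sub_t p hδ g).eq, ← mul_sub, hf, cyclicPoly, sub_sub_cancel]
    rw [hgd]
    exact S.sub_mem (hmul _ _ hg) (hmul _ _ hfS)
  obtain ⟨u, v, huv⟩ := (hmem 1).mp hone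
  exact PetitAlgebra.eq_zero_of_mul_eq_zero huv hab

/-- Right multiplication by an element of `K` does not raise the degree, so no reduction modulo `f`
occurs, and the descent by commutators with an eigenvector `x` runs inside any nonzero ideal. -/
lemma isSimpleRing (hδ : minpoly (constants δ) (constLinear δ) = X ^ p - X) (d : K) :
    IsSimpleRing (CyclicExt δ p d) := by
  obtain ⟨x, hx0, hx⟩ := exists_derivation_eq_self p hδ
  refine .of_eq_bot_or_eq_top fun I => ?_
  refine or_iff_not_imp_left.mpr fun hI => ?_
  obtain ⟨y, hy, hy0⟩ : ∃ y ∈ I, y ≠ 0 := by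
    by_contra! h
    refine hI (le_bot_iff.mp fun y hy => ?_)
    rw [TwoSidedIdeal.mem_bot]; exact h y hy
  have hconst (c : K) (y : CyclicExt δ p d) : ofField c * y = c • y := val_injective <| by
    rw [val_mul, val_ofField, const_mul, modr_smul, modr_of_lt _ (degree_val_lt y), map_smul]
  let S : Submodule K (DiffPoly δ) :=
    { carrier := {g | ∃ y ∈ I, val y = g}
      zero_mem' := ⟨0, I.zero_mem, map_zero _⟩
      add_mem' := by
        rintro _ _ ⟨y, hy, rfl⟩ ⟨z, hz, rfl⟩
        exact ⟨y + z, I.add_mem hy hz, map_add _ _ _⟩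
      smul_mem' := by
        rintro c _ ⟨y, hy, rfl⟩
        exact ⟨c • y, by rw [← hconst]; exact I.mul_mem_left _ _ hy, map_smul _ _ _⟩ }
  have hone : (1 : DiffPoly δ) ∈ S := by
    refine one_mem_of_mul_const_mem p S (x := x) (by rwa [hx]) ?_ ⟨y, hy, rfl⟩
      (fun h => hy0 (val_injective (h.trans (map_zero _).symm)))
      (by rw [← degree_cyclicPoly δ p d]; exact degree_val_lt y)
    rintro _ ⟨z, hz, rfl⟩ -
    refine ⟨z * ofField x, I.mul_mem_right _ _ hz, ?_⟩
    rw [val_mul, val_ofField, modr_of_lt]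
    rw [DiffPoly.degree_mul]
    refine lt_of_le_of_lt ?_ (degree_val_lt z)
    calc (val z).degree + (const x : DiffPoly δ).degree ≤ (val z).degree + 0 := by
          gcongr; exact degree_const_le x
      _ = (val z).degree := add_zero _
  obtain ⟨y, hy, hy1⟩ := hone
  rw [← val_one (f := cyclicPoly δ p d) (hf := degree_cyclicPoly_pos δ p d)] at hy1
  rw [val_injective hy1] at hy
  exact (TwoSidedIdeal.one_mem_iff I).mp hy

/-- A representation of `(K, δ, d)` of degree `p` over the constants is one-dimensional over `K`,
and provides a linear factor of `tᵖ - t - d`. -/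
lemma exists_eq_of_matrix_rep (hδ : minpoly (constants δ) (constLinear δ) = X ^ p - X) {d : K}
    {n : ℕ} [NeZero n] {D : Type*} [DivisionRing D] [Algebra (constants δ) D]
    (hD : Module.finrank (constants δ) (Fin n → D) = p)
    (ρ : DiffPoly δ →+* Matrix (Fin n) (Fin n) D)
    (hsmul : ∀ (c : constants δ) g, ρ (c • g) = c • ρ g) (hf : ρ (cyclicPoly δ p d) = 0) :
    ∃ z : K, z ^ p + δ^[p - 1] z - z = d := by
  have hK := _root_.finrank_constants p hδ
  have := Module.finite_of_finrank_pos (hK ▸ hp.out.pos)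
  have := Module.finite_of_finrank_pos (hD ▸ hp.out.pos)
  let v : Fin n → D := Pi.single 0 1
  have hv : v ≠ 0 := by simp [v]
  let ψ : K →ₗ[constants δ] (Fin n → D) :=
    { toFun := fun a => (ρ (const a)).mulVec v
      map_add' := fun a b => by
        rw [← constHom_apply, map_add, map_add, Matrix.add_mulVec]; rfl
      map_smul' := fun c a => by
        have h : (const (c • a) : DiffPoly δ) = c • const a := by
          rw [const_eq_smul_one, const_eq_smul_one, smul_assoc]
        rw [h, hsmul, Matrix.smul_mulVec, RingHom.id_apply] }
  have hψ (a : K) (ha : ψ a = 0) : a = 0 := by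
    by_contra ha0
    have h : (ρ (const a⁻¹)).mulVec (ψ a) = v := by
      change (ρ (const a⁻¹)).mulVec ((ρ (const a)).mulVec v) = v
      rw [Matrix.mulVec_mulVec, ← map_mul, ← constHom_apply, ← constHom_apply, ← map_mul,
        inv_mul_cancel₀ ha0, map_one, map_one, Matrix.one_mulVec]
    rw [ha, Matrix.mulVec_zero] at h
    exact hv h.symm
  -- Source and target both have dimension `p` over the constants, so `v` generates the module over
  -- `K` and `t v = z v` for some `z`.
  have hsurj : Function.Surjective ψ :=
    (LinearMap.injective_iff_surjective_of_finrank_eq_finrank (hK.trans hD.symm)).mp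
      ((injective_iff_map_eq_zero ψ).mpr hψ)
  obtain ⟨z, hz⟩ := hsurj ((ρ t).mulVec v)
  have hz' : (ρ (t - const z)).mulVec v = 0 := by
    rw [map_sub, Matrix.sub_mulVec, ← hz]; exact sub_self _
  refine ⟨z, sub_eq_zero.mp (hψ _ ?_)⟩
  -- This constant is the remainder of `f` on right division by `t - z`. Both `f` and `t - z` kill
  -- `v`, so the constant kills it too and is zero.
  have hcf : (const (z ^ p + δ^[p - 1] z - z - d) : DiffPoly δ) =
      cyclicPoly δ p d - ((t - const z) ^ (p - 1) - 1) * (t - const z) := by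
    rw [sub_mul, ← pow_succ, Nat.sub_add_cancel hp.out.one_le, t_sub_const_pow_char, cyclicPoly,
      one_mul]
    simp only [← constHom_apply, map_sub]
    abel
  change (ρ (const _)).mulVec v = 0
  rw [hcf, map_sub, hf, zero_sub, Matrix.neg_mulVec, map_mul, ← Matrix.mulVec_mulVec, hz',
    Matrix.mulVec_zero, neg_zero]

/-- For constant `d` the algebra is associative, simple and finite-dimensional, so Wedderburn's
theorem applies. Zero divisors exclude matrix size `1`, and the dimension `p²` forces size `p` over
the constants. -/
lemma exists_eq_of_mul_eq_zero (hδ : minpoly (constants δ) (constLinear δ) = X ^ p - X) {d : K}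
    (hd : δ d = 0) {a b : CyclicExt δ p d} (hab : a * b = 0) (ha : a ≠ 0) (hb : b ≠ 0) :
    ∃ z : K, z ^ p + δ^[p - 1] z - z = d := by
  have hcomm := commute_cyclicPoly p (derivation_iterate_prime p hδ) hd
  have hrank := finrank_constants p hδ d
  have hfin : Module.Finite (constants δ) (CyclicExt δ p d) :=
    Module.finite_of_finrank_pos (hrank ▸ pow_pos hp.out.pos 2)
  have hsimple := isSimpleRing p hδ d
  let π := projOfCommute (hf := degree_cyclicPoly_pos δ p d) hcomm
  let _ := ringOfCommute (hf := degree_cyclicPoly_pos δ p d) hcomm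
  let _ := algebraOfCommute (hf := degree_cyclicPoly_pos δ p d) hcomm
  have : IsArtinianRing (CyclicExt δ p d) := IsArtinianRing.of_finite (constants δ) _
  obtain ⟨n, hn, D, _, _, _, ⟨e⟩⟩ :=
    IsSimpleRing.exists_algEquiv_matrix_divisionRing_finite (constants δ) (CyclicExt δ p d)
  have hdim : n * n * Module.finrank (constants δ) D = p ^ 2 := by
    rw [← hrank]
    refine Eq.trans ?_ e.toLinearEquiv.finrank_eq.symm
    rw [Module.finrank_matrix, Fintype.card_fin]
  have hdvd : n ∣ p := (Nat.pow_dvd_pow_iff two_ne_zero).mp ⟨_, by rw [← hdim, sq]⟩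
  rcases (Nat.dvd_prime hp.out).mp hdvd with rfl | rfl
  · have h : e a * e b = 0 := by rw [← map_mul]; exact (congrArg e hab).trans (map_zero e)
    have h00 : e a 0 0 * e b 0 0 = 0 := by
      simpa [Matrix.mul_apply] using congrFun (congrFun h 0) 0
    have hz (c : CyclicExt δ p d) (hc : e c 0 0 = 0) : c = 0 := by
      refine (map_eq_zero_iff e e.injective).mp ?_
      ext i j
      rw [Subsingleton.elim i 0, Subsingleton.elim j 0, hc, Matrix.zero_apply]
    rcases mul_eq_zero.mp h00 with h | h
    · exact absurd (hz a h) ha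
    · exact absurd (hz b h) hb
  -- In this case the matrix size is the prime itself, and both go by the name `n` after the
  -- substitution.
  · have hD : Module.finrank (constants δ) D = 1 := by
      have : 0 < n * n := Nat.mul_pos hp.out.pos hp.out.pos
      rw [sq] at hdim
      exact Nat.eq_of_mul_eq_mul_left this (hdim.trans (mul_one _).symm)
    refine exists_eq_of_matrix_rep n hδ (n := n) (D := D) ?_
      ((e : CyclicExt δ n d →+* Matrix (Fin n) (Fin n) D).comp π) ?_ ?_
    · rw [Module.finrank_pi_fintype, hD]; simp
    · intro c g
      refine Eq.trans (congrArg e ?_) (map_smul e c (π g))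
      exact val_injective (modr_smul _ (degree_cyclicPoly_pos δ n d) (c : K) g)
    · refine Eq.trans (congrArg e ?_) (map_zero e)
      refine val_injective ?_
      exact (modr_self (hf := degree_cyclicPoly_pos δ n d)).trans (map_zero _).symm

/-- If `tᵖ - t - d` has a right factor `t - z`, then `(K, δ, d)` has zero divisors. -/
lemma not_isDivisionAlgebra {z d : K} (hz : z ^ p + δ^[p - 1] z - z = d) :
    ¬ IsDivisionAlgebra (CyclicExt δ p d) := by
  intro hdiv
  have hfac : cyclicPoly δ p d = ((t - const z) ^ (p - 1) - 1) * (t - const z) := by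
    rw [sub_mul, ← pow_succ, Nat.sub_add_cancel hp.out.one_le, t_sub_const_pow_char, cyclicPoly,
      one_mul, ← hz]
    simp only [← constHom_apply, map_sub]
    abel
  have hlin : (t - const z : DiffPoly δ).degree = 1 := degree_X_sub_C z
  have hdeg := congrArg DiffPoly.degree hfac
  rw [degree_cyclicPoly, DiffPoly.degree_mul, hlin] at hdeg
  have hp1 : 1 < p := hp.out.one_lt
  -- The cofactor's degree is not computed: additivity of degrees says that adding `1` to it gives
  -- `p`.
  have hlt : ((t - const z) ^ (p - 1) - 1 : DiffPoly δ).degree < (cyclicPoly δ p d).degree := by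
    rw [degree_cyclicPoly, hdeg]
    generalize ((t - const z) ^ (p - 1) - 1 : DiffPoly δ).degree = k at hdeg ⊢
    cases k with
    | bot => simp at hdeg
    | coe k => exact WithBot.coe_lt_coe.mpr (Nat.lt_succ_self k)
  have hlt' : (t - const z : DiffPoly δ).degree < (cyclicPoly δ p d).degree := by
    rw [degree_cyclicPoly, hlin]; exact_mod_cast hp1
  let a : CyclicExt δ p d := mk _ hlt
  let b : CyclicExt δ p d := mk _ hlt'
  have hab : a * b = 0 := val_injective <| by
    refine (congrArg (modr _ (degree_cyclicPoly_pos δ p d)) hfac.symm).trans ?_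
    rw [modr_self, map_zero]
  have hb : b ≠ 0 := by
    intro h
    have : (t - const z : DiffPoly δ) = 0 := (congrArg val h).trans (map_zero _)
    rw [this, DiffPoly.degree_zero] at hlin
    exact absurd hlin (by simp)
  have ha : a ≠ 0 := by
    intro h
    have : ((t - const z) ^ (p - 1) - 1 : DiffPoly δ) = 0 := (congrArg val h).trans (map_zero _)
    rw [this, DiffPoly.degree_zero] at hdeg
    exact absurd hdeg (by simp)
  exact hb ((hdiv.2 a ha).1.1 (show a * b = a * 0 by rw [hab, mul_zero]))

lemma isDivisionAlgebra_iff (hδ : minpoly (constants δ) (constLinear δ) = X ^ p - X) (d : K) :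
    IsDivisionAlgebra (CyclicExt δ p d) ↔ ∀ z : K, z ^ p + δ^[p - 1] z - z ≠ d := by
  refine ⟨fun h z hz => not_isDivisionAlgebra p hz h, fun h => ?_⟩
  have : Module.Finite (constants δ) (CyclicExt δ p d) :=
    Module.finite_of_finrank_pos (finrank_constants p hδ d ▸ pow_pos hp.out.pos 2)
  refine isDivisionAlgebra fun a b hab => ?_
  by_contra! hne
  by_cases hd : δ d = 0
  · obtain ⟨z, hz⟩ := exists_eq_of_mul_eq_zero p hδ hd hab hne.1 hne.2
    exact h z hz
  · exact hne.1 (eq_zero_of_mul_eq_zero_of_derivation_ne_zero p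
      (derivation_iterate_prime p hδ) hd hab hne.2)

/-! ### The automorphism `t ↦ t - 1` -/

/-- The substitution fixes `f` and preserves the bound on degrees, so it carries a division with
remainder by `f` to another one. -/
lemma shiftLinear_mul {d : K} (x y : CyclicExt δ p d) :
    shiftLinear p δ d (x * y) = shiftLinear p δ d x * shiftLinear p δ d y := val_injective <| by
  rw [val_mul (shiftLinear p δ d x), val_shiftLinear p x, val_shiftLinear p y,
    ← map_mul (shift δ (-1))]
  obtain ⟨q, hq⟩ := exists_eq_mul_add_modr (cyclicPoly δ p d) (degree_cyclicPoly_pos δ p d)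
    (val x * val y)
  refine (modr_eq _ (q := shift δ (-1) q) (degree_val_lt (shiftLinear p δ d (x * y))) ?_).symm
  conv_lhs => rw [hq, map_add, map_mul, shift_cyclicPoly]
  rfl

lemma shiftLinear_iterate {d : K} (x : CyclicExt δ p d) : (shiftLinear p δ d)^[p] x = x := by
  have h (n : ℕ) : val ((shiftLinear p δ d)^[n] x) = (shift δ (-1))^[n] (val x) := by
    induction n with
    | zero => rfl
    | succ n ih => rw [Function.iterate_succ_apply', val_shiftLinear, ih,
        Function.iterate_succ_apply']
  exact val_injective ((h p).trans (shift_iterate_char p _ _))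

lemma shiftLinear_bijective (d : K) : Function.Bijective (shiftLinear p δ d) := by
  have h : (shiftLinear p δ d)^[(p - 1).succ] = id := by
    rw [Nat.succ_eq_add_one, Nat.sub_add_cancel hp.out.one_le]
    exact funext (shiftLinear_iterate p)
  exact ⟨Function.LeftInverse.injective (g := (shiftLinear p δ d)^[p - 1]) fun x => by
      rw [← Function.iterate_succ_apply (shiftLinear p δ d), h, id],
    Function.RightInverse.surjective (g := (shiftLinear p δ d)^[p - 1]) fun x => by
      rw [← Function.iterate_succ_apply' (shiftLinear p δ d), h, id]⟩

variable (δ) in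
/-- The automorphism `∑ aᵢ tⁱ ↦ ∑ aᵢ (t - 1)ⁱ` of `(K, δ, d)`. -/
def shiftAut (d : K) : algebraAut (constants δ) (CyclicExt δ p d) :=
  ⟨LinearEquiv.ofBijective (shiftLinear p δ d) (shiftLinear_bijective p d), shiftLinear_mul p⟩

lemma shiftAut_apply {d : K} (x : CyclicExt δ p d) :
    (shiftAut p δ d).1 x = shiftLinear p δ d x := rfl

lemma shiftAut_gen (d : K) : (shiftAut p δ d).1 (gen δ p d) = gen δ p d - 1 :=
  val_injective <| by
    rw [shiftAut_apply, val_shiftLinear, map_sub, val_one]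
    change shift δ (-1) t = t - 1
    rw [shift_t, ← constHom_apply, map_neg, map_one, sub_eq_add_neg]

lemma shiftAut_ofField {d : K} (a : K) :
    (shiftAut p δ d).1 (ofField a) = ofField a := val_injective (shift_const (-1) a)

lemma orderOf_shiftAut (d : K) : orderOf (shiftAut p δ d) = p := by
  refine orderOf_eq_prime (Subtype.ext (LinearEquiv.ext fun x => ?_)) fun h => ?_
  · have hpow (n : ℕ) : ((shiftAut p δ d) ^ n).1 x = (shiftLinear p δ d)^[n] x := by
      induction n with
      | zero => rfl
      | succ n ih =>
        rw [pow_succ', Function.iterate_succ_apply', ← ih]; rfl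
    exact (hpow p).trans (shiftLinear_iterate p x)
  · have h1 := shiftAut_gen p (δ := δ) d
    rw [h] at h1
    have h2 : gen δ p d = gen δ p d - 1 := h1
    exact one_ne_zero (sub_eq_self.mp h2.symm)

end CyclicExt

end

/-! ### The theorem. -/

theorem mainTheorem2 {K : Type*} [Field K] (p : ℕ) [Fact p.Prime] [CharP K p]
    (δ : Derivation ℤ K K)
    (hδ : minpoly (constants δ) (constLinear δ) = Polynomial.X ^ p - Polynomial.X)
    (d : K) :
    Module.finrank (constants δ) (CyclicExt δ p d) = p ^ 2 ∧
    (∀ z : K, ((DiffPoly.t : DiffPoly δ) - DiffPoly.const z) ^ p =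
      DiffPoly.t ^ p - DiffPoly.const (DiffPoly.vMap δ p z)) ∧
    (IsDivisionAlgebra (CyclicExt δ p d) ↔ ∀ z : K, DiffPoly.vMap δ p z - z ≠ d) ∧
    (IsDivisionAlgebra (CyclicExt δ p d) ↔ ∀ z : K, z ^ p + δ^[p - 1] z - z ≠ d) ∧
    ∃ G : algebraAut (constants δ) (CyclicExt δ p d),
      (∀ x : CyclicExt δ p d,
        PetitAlgebra.val (G.1 x) =
          DiffPoly.substMap δ (RingEquiv.refl K) (-1) (PetitAlgebra.val x)) ∧
      G.1 (CyclicExt.gen δ p d) = CyclicExt.gen δ p d - 1 ∧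
      (∀ a : K, G.1 (PetitAlgebra.ofField a) = PetitAlgebra.ofField a) ∧
      IsCyclic (Subgroup.zpowers G) ∧
      Nat.card (Subgroup.zpowers G) = p := by
  refine ⟨CyclicExt.finrank_constants p hδ d, fun z => ?_, ?_,
    CyclicExt.isDivisionAlgebra_iff p hδ d, CyclicExt.shiftAut p δ d, fun x => rfl,
    CyclicExt.shiftAut_gen p d, CyclicExt.shiftAut_ofField p, inferInstance, ?_⟩
  · rw [DiffPoly.vMap_eq, DiffPoly.t_sub_const_pow_char]
  · simp only [DiffPoly.vMap_eq]
    exact CyclicExt.isDivisionAlgebra_iff p hδ d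
  · rw [Nat.card_zpowers, CyclicExt.orderOf_shiftAut]
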